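/- **Definitions.** For a finite group $G\le \operatorname{O}(d)$ acting on $\mathbb{R}^d$, $d\ge 1$, put $\langle\!\langle G\cdot x,G\cdot y\rangle\!\rangle:=\sup\{\langle p,q\rangle: p\in G\cdot x,\ q\in G\cdot y\}$, and equip $\mathbb{R}^d/G$ with the metric $\operatorname{dist}(G\cdot x,G\cdot y):=\inf\{\|p-q\|:p\in G\cdot x,\ q\in G\cdot y\}$. The max filter bank with templates $t_1,\dots,t_n\in\mathbb{R}^d$ is the map $\Phi:\mathbb{R}^d/G\to\mathbb{R}^n$, $\Phi(G\cdot x)=(\langle\!\langle G\cdot t_i,G\cdot x\rangle\!\rangle)_{i=1}^n$. The optimal max filtering condition number $\kappa(G)$ is the infimum of the quotients $C/c$, over all $n$ and all templates $t_1,\dots,t_n$ whose max filter bank has upper Lipschitz bound $C$ and lower Lipschitz bound $c>0$. Templates are *optimal* if their max filter bank has Lipschitz bounds $C,c$ with $C/c=\kappa(G)$, and *minimal optimal* if moreover no optimal family has fewer members. For $u\neq0$ let $R(u)$ be the reflection in the hyperplane $u^\perp$. A *reflection group* is a subgroup of $\operatorname{O}(d)$ generated by a (possibly empty) set of such reflections.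 It is *essential* if the origin is its only fixed point, and *irreducible* if it is not the internal direct product of two nontrivial reflection groups in $\operatorname{O}(d)$. A *Weyl chamber* $C$ of a finite reflection group $G$ is a connected component of the complement of the union of the hyperplanes fixed by reflections in $G$. The boundary of $C$ is contained in a union of $\ell$ (and no fewer) hyperplanes of reflections $R(\alpha_1),\dots,R(\alpha_\ell)\in G$; the unit vectors $\alpha_1,\dots,\alpha_\ell$, signed so that they lie in the dual cone of $C$, form the *fundamental system* of $G$ corresponding to $C$. **Theorem.** Let $d\ge1$ and let $G\le\operatorname{O}(d)$ be a finite reflection group. (a) If $G$ is trivial, then $\kappa(G)=1$, and any orthonormal basis of $\mathbb{R}^d$ is a family of minimal optimal templates. (b) If $G$ is essential and irreducible, then for any matrix $A\in\mathbb{R}^{d\times d}$ whose unit-norm rows form a fundamental system of $G$, $A$ is invertible, $\kappa(G)=\sigma_{\max}(A)/\sigma_{\min}(A)$, and the $d$ columns of $A^{-1}$ are minimal optimal templates. (c) In general, there are an orthogonal decomposition $\mathbb{R}^d\cong\bigoplus_{i=1}^k\mathbb{R}^{d_i}$ with all $d_i\ge1$ and reflection groups $G_i\le\operatorname{O}(d_i)$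 such that $G$ is the product $G_1\times\cdots\times G_k$ acting componentwise, each $G_i$ is either trivial or both essential and irreducible, and at most one $G_i$ is trivial. Moreover, for every decomposition of $G$ into reflection groups $G_i\le\operatorname{O}(d_i)$, $d_i\geq 1$, of this kind (even with several trivial $G_i$): some $G_i$ is trivial if and only if $G$ is not essential; $\kappa(G)=\max_i\kappa(G_i)$; and minimal optimal templates for $G$ are given by the orthogonal direct sum of the templates for the $G_i$ described in (a) and (b), that is, of an arbitrary orthonormal basis of $\mathbb{R}^{d_i}$ if $G_i$ is trivial, and of the columns of $A_i^{-1}$ otherwise, where the unit-norm rows of $A_i\in\mathbb{R}^{d_i\times d_i}$ form a fundamental system of $G_i$. -/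

import Mathlib

open scoped ENNReal

namespace MaxFiltering

/-- The Euclidean space `ℝ^d`. -/
abbrev Euc (d : ℕ) : Type := EuclideanSpace ℝ (Fin d)

/-- The orthogonal group `O(V)`: all linear isometries of `V` onto itself, under composition. -/
abbrev O (V : Type*) [NormedAddCommGroup V] [InnerProductSpace ℝ V] : Type _ := V ≃ₗᵢ[ℝ] V

section MaxFilter

variable {V : Type*} [NormedAddCommGroup V] [InnerProductSpace ℝ V]

/-- The orbit `G · x`. -/
def orbit (G : Subgroup (O V)) (x : V) : Set V := {y | ∃ g ∈ G, g x = y}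

/-- The max filtering map
`⟪⟪G · x, G · y⟫⟫ = sup {⟨p, q⟩ : p ∈ G · x, q ∈ G · y}`. -/
noncomputable def maxFilter (G : Subgroup (O V)) (x y : V) : ℝ :=
  sSup {r : ℝ | ∃ p ∈ orbit G x, ∃ q ∈ orbit G y, r = inner ℝ p q}

/-- The quotient Euclidean metric on `V / G`:
`dist(G · x, G · y) = inf {‖p - q‖ : p ∈ G · x, q ∈ G · y}`. -/
noncomputable def orbitDist (G : Subgroup (O V)) (x y : V) : ℝ :=
  sInf {r : ℝ | ∃ p ∈ orbit G x, ∃ q ∈ orbit G y, r = ‖p - q‖}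

/-- The max filter bank with templates `t`, evaluated at the orbit `G · x`. -/
noncomputable def maxFilterBank (G : Subgroup (O V)) {ι : Type*} (t : ι → V) (x : V) :
    EuclideanSpace ℝ ι :=
  WithLp.toLp 2 fun i => maxFilter G (t i) x

/-- The max filter bank `V / G → ℝ^ι` with templates `t` has lower Lipschitz bound `c > 0` and
upper Lipschitz bound `C`. -/
def HasLipschitzBounds (G : Subgroup (O V)) {ι : Type*} [Fintype ι] (t : ι → V) (c C : ℝ) :
    Prop :=
  0 < c ∧ 0 ≤ C ∧ ∀ x y : V,
    c * orbitDist G x y ≤ ‖maxFilterBank G t x - maxFilterBank G t y‖ ∧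
      ‖maxFilterBank G t x - maxFilterBank G t y‖ ≤ C * orbitDist G x y

/-- The optimal max filtering condition number `κ(G)`: the infimum of the quotients `C / c` of
Lipschitz bounds of max filter banks with finitely many templates. It takes values in `[0, ∞]`, so
that it would be `∞` if no max filter bank were bilipschitz. -/
noncomputable def kappa (G : Subgroup (O V)) : ℝ≥0∞ :=
  sInf {r : ℝ≥0∞ | ∃ (n : ℕ) (t : Fin n → V) (c C : ℝ),
    HasLipschitzBounds G t c C ∧ r = ENNReal.ofReal (C / c)}

/-- The templates `t` attain the optimal condition number `κ(G)`. -/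
def IsOptimal (G : Subgroup (O V)) {ι : Type*} [Fintype ι] (t : ι → V) : Prop :=
  ∃ c C : ℝ, HasLipschitzBounds G t c C ∧ ENNReal.ofReal (C / c) = kappa G

/-- The templates `t` are optimal, and no optimal family has fewer templates. -/
def IsMinimalOptimal (G : Subgroup (O V)) {ι : Type*} [Fintype ι] (t : ι → V) : Prop :=
  IsOptimal G t ∧ ∀ (n : ℕ) (s : Fin n → V), IsOptimal G s → Fintype.card ι ≤ n

end MaxFilter

section ReflectionGroups

variable {V : Type*} [NormedAddCommGroup V] [InnerProductSpace ℝ V]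

/-- `R(u)`, the reflection in the hyperplane orthogonal to `u`. -/
noncomputable def refl (u : V) : O V := (ℝ ∙ u)ᗮ.reflection

/-- `g` is a reflection: `g = R(u)` for some nonzero vector `u`. -/
def IsReflection (g : O V) : Prop := ∃ u : V, u ≠ 0 ∧ g = refl u

/-- A reflection group is a group generated by a set of reflections (the empty set, which generates
the trivial group, is allowed). -/
def IsReflectionGroup (G : Subgroup (O V)) : Prop :=
  ∃ S : Set (O V), (∀ s ∈ S, IsReflection s) ∧ Subgroup.closure S = G

/-- The origin is the only fixed point of `G`. -/
def IsEssential (G : Subgroup (O V)) : Prop :=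
  ∀ x : V, (∀ g ∈ G, g x = x) → x = 0

/-- `G` is the (internal) direct product of two nontrivial reflection groups. -/
def IsReducible (G : Subgroup (O V)) : Prop :=
  ∃ H K : Subgroup (O V), IsReflectionGroup H ∧ IsReflectionGroup K ∧ H ≠ ⊥ ∧ K ≠ ⊥ ∧
    (∀ h ∈ H, ∀ k ∈ K, h * k = k * h) ∧ H ⊓ K = ⊥ ∧ H ⊔ K = G

/-- `G` is not reducible as a reflection group. -/
def IsIrreducible (G : Subgroup (O V)) : Prop := ¬ IsReducible G

/-- The union of the hyperplanes fixed by the reflections in `G`. -/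
def mirrors (G : Subgroup (O V)) : Set V := {x | ∃ g ∈ G, IsReflection g ∧ g x = x}

/-- A Weyl chamber of `G`: a connected component of the complement of the mirrors. -/
def IsWeylChamber (G : Subgroup (O V)) (C : Set V) : Prop :=
  ∃ x ∈ (mirrors G)ᶜ, C = connectedComponentIn (mirrors G)ᶜ x

/-- `α` is the fundamental system of `G` corresponding to the Weyl chamber `C`: the `α i` are unit
vectors in the dual cone of `C`, the `R(α i)` are reflections in `G` whose hyperplanes cover the
boundary of `C`, and no fewer hyperplanes of reflections in `G` cover it. -/
def IsFundamentalSystemOf (G : Subgroup (O V)) (C : Set V) {ι : Type*} [Fintype ι] (α : ι → V) :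
    Prop :=
  (∀ i, ‖α i‖ = 1) ∧
  (∀ i, ∀ x ∈ C, 0 ≤ inner ℝ (α i) x) ∧
  (∀ i, refl (α i) ∈ G) ∧
  (∀ x ∈ frontier C, ∃ i, inner ℝ (α i) x = 0) ∧
  (∀ S : Finset V, (∀ u ∈ S, u ≠ 0 ∧ refl u ∈ G) →
    (∀ x ∈ frontier C, ∃ u ∈ S, inner ℝ u x = 0) → Fintype.card ι ≤ S.card)

/-- `α` is a fundamental system of `G`, that is, the one corresponding to some Weyl chamber. -/
def IsFundamentalSystem (G : Subgroup (O V)) {ι : Type*} [Fintype ι] (α : ι → V) : Prop :=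
  ∃ C : Set V, IsWeylChamber G C ∧ IsFundamentalSystemOf G C α

end ReflectionGroups

section Matrices

variable {d : ℕ}

/-- The `i`-th row of `A`, as a vector in `ℝ^d`. -/
def row (A : Matrix (Fin d) (Fin d) ℝ) (i : Fin d) : Euc d := WithLp.toLp 2 fun j => A i j

/-- The `j`-th column of `A`, as a vector in `ℝ^d`. -/
def col (A : Matrix (Fin d) (Fin d) ℝ) (j : Fin d) : Euc d := WithLp.toLp 2 fun i => A i j

/-- The largest singular value of a `d × d` matrix, `d ≥ 1`. -/
noncomputable def sigmaMax (A : Matrix (Fin d) (Fin d) ℝ) : ℝ :=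
  (Matrix.toEuclideanLin A).singularValues 0

/-- The smallest singular value of a `d × d` matrix, `d ≥ 1` (singular values are listed in
decreasing order, starting with index `0`). -/
noncomputable def sigmaMin (A : Matrix (Fin d) (Fin d) ℝ) : ℝ :=
  (Matrix.toEuclideanLin A).singularValues (d - 1)

/-- The distinguished templates for an irreducible constituent `G ≤ O(d)`: an orthonormal basis if
`G` is trivial, and the columns of `A⁻¹` if `G` is essential and irreducible and the unit-norm rows
of `A` form a fundamental system of `G`. -/
def IsConstituentTemplates (G : Subgroup (O (Euc d))) (t : Fin d → Euc d) : Prop :=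
  (G = ⊥ ∧ ∃ b : OrthonormalBasis (Fin d) ℝ (Euc d), t = b) ∨
  (IsEssential G ∧ IsIrreducible G ∧
    ∃ A : Matrix (Fin d) (Fin d) ℝ, IsFundamentalSystem G (row A) ∧ t = col A⁻¹)

end Matrices

section DirectSums

variable {d k : ℕ} {δ : Fin k → ℕ}

/-- The isometry `e` from `⨁ i, ℝ^(δ i)` onto `ℝ^d` carries the product of the groups
`G i ≤ O(δ i)`, acting componentwise, onto `G`. -/
def IsDirectProduct (G : Subgroup (O (Euc d))) (Gi : ∀ i, Subgroup (O (Euc (δ i))))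
    (e : PiLp 2 (fun i => Euc (δ i)) ≃ₗᵢ[ℝ] Euc d) : Prop :=
  ∀ g : O (Euc d), g ∈ G ↔ ∃ h : ∀ i, O (Euc (δ i)), (∀ i, h i ∈ Gi i) ∧
    ∀ (x : PiLp 2 (fun i => Euc (δ i))) (i : Fin k), e.symm (g (e x)) i = h i (x i)

/-- A decomposition of `G ≤ O(d)` into irreducible constituents `G i ≤ O(δ i)`, `δ i ≥ 1`: each of
them is a reflection group that is either trivial or both essential and irreducible. -/
def IsConstituentDecomposition (G : Subgroup (O (Euc d)))
    (Gi : ∀ i, Subgroup (O (Euc (δ i))))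
    (e : PiLp 2 (fun i => Euc (δ i)) ≃ₗᵢ[ℝ] Euc d) : Prop :=
  (∀ i, 1 ≤ δ i) ∧ IsDirectProduct G Gi e ∧
  ∀ i, IsReflectionGroup (Gi i) ∧ (Gi i = ⊥ ∨ (IsEssential (Gi i) ∧ IsIrreducible (Gi i)))

/-- The orthogonal direct sum of families of vectors `t i : Fin (δ i) → ℝ^(δ i)`, moved to `ℝ^d` by
the isometry `e`: the `j`-th vector of the `i`-th family is put into the `i`-th summand. -/
noncomputable def directSum (e : PiLp 2 (fun i => Euc (δ i)) ≃ₗᵢ[ℝ] Euc d)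
    (t : ∀ i, Fin (δ i) → Euc (δ i)) : (Σ i, Fin (δ i)) → Euc d :=
  fun p => e (PiLp.single 2 p.1 (t p.1 p.2))

end DirectSums

end MaxFiltering

namespace MaxFiltering

/-! ### Reflections and roots -/

section Reflections

variable {V : Type*} [NormedAddCommGroup V] [InnerProductSpace ℝ V]

/-! A closed Weyl chamber is a fundamental domain on which the quotient is flat: for two points of
it, the max filter is their inner product and the orbit distance is the norm of their difference
(`inner_map_le`, `maxFilter_eq_inner`, `orbitDist_eq_norm`). Templates may be moved into the
chamber, and since the chamber has interior points, Lipschitz bounds become frame bounds of the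
templates (`hasLipschitzBounds_iff`). In particular at least `d` templates are needed.

Let the rows `α i` of `A` be the simple roots, and let `m`, `M` be the extreme singular values of
`A`. The columns of `A⁻¹` are the dual basis, lie in the chamber, and have frame bounds `1/M` and
`1/m`. Conversely, a template `t` in the chamber has `⟨t, α i⟩ ≥ 0`, so replacing `∑ w i • α i` by
`∑ |w i| • α i` cannot decrease `|⟨t, ·⟩|`; this gives `c ‖∑ w i • α i‖ ≤ C ‖∑ |w i| • α i‖`
(`norm_sum_le_of_hasLipschitzBounds`). The Coxeter graph is bipartite (`exists_two_coloring`), so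
the sign change given by a 2-colouring turns the Gram matrix `1 + N` into `1 - N`
(`norm_sq_sum_coloring`). Hence `m² + M² = 2`, and if `w` attains `M`, then the right-hand side is
at most `C m ‖w‖`, because the Gram entries off the diagonal are nonpositive. Thus `C / c ≥ M / m`
(`hasBalancedBounds_of_isFundamentalSystem`).

For a product, squared distances and max filters add over the factors. The relation `m² + M² = 2`,
which the trivial group satisfies with `m = M = 1`, makes the factor with the largest `M` also the
one with the smallest `m`. The direct sum of the optimal templates therefore attains the largest
factor's condition number without rescaling (`IsDirectProduct.isMinimalOptimal_directSum`). The
decomposition itself comes from classes of roots connected by non-orthogonality, together with the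
fixed space (`exists_isConstituentDecomposition`). -/

theorem refl_apply (u x : V) : refl u x = x - (2 * (inner ℝ u x / ‖u‖ ^ 2)) • u := by
  unfold refl
  rw [Submodule.reflection_orthogonal_apply, Submodule.reflection_singleton_apply]
  simp only [RCLike.ofReal_real_eq_id, id, two_smul, two_mul, add_smul]
  abel

theorem refl_apply_of_norm {u : V} (hu : ‖u‖ = 1) (x : V) :
    refl u x = x - (2 * inner ℝ u x) • u := by
  rw [refl_apply, hu]; simp

theorem refl_self (u : V) : refl u u = -u :=
  Submodule.reflection_orthogonalComplement_singleton_eq_neg u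

theorem refl_refl (u x : V) : refl u (refl u x) = x := by
  unfold refl; exact Submodule.reflection_reflection _ _

theorem refl_mul_self (u : V) : refl u * refl u = 1 := by
  ext x; exact refl_refl u x

theorem refl_smul {a : ℝ} (ha : a ≠ 0) (u : V) : refl (a • u) = refl u := by
  unfold refl
  congr 2
  exact Submodule.span_singleton_smul_eq (IsUnit.mk0 a ha) u

theorem refl_neg (u : V) : refl (-u) = refl u := by
  rw [← refl_smul (a := -1) (by norm_num) u, neg_one_smul]

theorem refl_fix_iff (u x : V) : refl u x = x ↔ inner ℝ u x = 0 := by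
  unfold refl
  rw [Submodule.reflection_eq_self_iff, Submodule.mem_orthogonal_singleton_iff_inner_right]

theorem inner_map_left (g : O V) (x y : V) : inner ℝ (g x) y = inner ℝ x (g⁻¹ y) := by
  have h : y = g (g⁻¹ y) := (g.apply_symm_apply y).symm
  conv_lhs => rw [h]
  exact g.inner_map_map _ _

theorem inner_map_right (g : O V) (x y : V) : inner ℝ x (g y) = inner ℝ (g⁻¹ x) y := by
  rw [inner_map_left, inv_inv]

theorem refl_map (g : O V) (u : V) : refl (g u) = g * refl u * g⁻¹ := by
  ext x
  change _ = g (refl u (g⁻¹ x))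
  rw [refl_apply, refl_apply, map_sub, map_smul, inner_map_left, g.norm_map]
  congr 1
  exact (g.apply_symm_apply x).symm

theorem refl_eq_iff {u v : V} (hu : ‖u‖ = 1) (hv : ‖v‖ = 1) :
    refl u = refl v ↔ u = v ∨ u = -v := by
  constructor
  · intro h
    have h1 : refl v u = -u := by rw [← h, refl_self]
    rw [refl_apply_of_norm hv] at h1
    have h2 : u = (inner ℝ v u : ℝ) • v := by
      have h3 : (2 : ℝ) • u = (2 : ℝ) • ((inner ℝ v u : ℝ) • v) := by
        rw [smul_smul, two_smul]
        have := congrArg (fun z => z + (2 * inner ℝ v u : ℝ) • v + u) h1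
        simpa using this
      exact smul_right_injective V (two_ne_zero' ℝ) h3
    have h4 : |(inner ℝ v u : ℝ)| = 1 := by
      have := congrArg norm h2
      rw [norm_smul, hu, hv, mul_one, Real.norm_eq_abs] at this
      exact this.symm
    rcases (abs_eq zero_le_one).1 h4 with h5 | h5
    · left; rw [h2, h5, one_smul]
    · right; rw [h2, h5, neg_one_smul]
  · rintro (rfl | rfl)
    · rfl
    · exact refl_neg v

omit [InnerProductSpace ℝ V] in
theorem ne_zero_of_norm_eq_one {u : V} (hu : ‖u‖ = 1) : u ≠ 0 := by
  rintro rfl; simp at hu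

theorem refl_ne_one {u : V} (hu : u ≠ 0) : refl u ≠ 1 := by
  intro h1
  have h2 := refl_self u
  rw [h1] at h2
  change u = -u at h2
  have h3 : (2 : ℝ) • u = 0 := by
    rw [two_smul]
    nth_rewrite 1 [h2]
    exact neg_add_cancel u
  exact hu ((smul_eq_zero.1 h3).resolve_left two_ne_zero)

/-- The unit vectors whose reflections belong to `G`. -/
def roots (G : Subgroup (O V)) : Set V := {u | ‖u‖ = 1 ∧ refl u ∈ G}

variable {G : Subgroup (O V)}

/-- On unit vectors, `refl` has fibres of the form `{v, -v}`, so finitely many reflections have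
finitely many unit normals. -/
theorem roots_finite (hfin : Finite G) : (roots G).Finite := by
  have h1 : ((G : Set (O V))).Finite := Set.toFinite _
  have : (roots G ⊆ ⋃ g ∈ (G : Set (O V)), {u | ‖u‖ = 1 ∧ refl u = g}) := by
    intro u hu
    simp only [Set.mem_iUnion]
    exact ⟨refl u, hu.2, hu.1, rfl⟩
  refine (h1.biUnion ?_).subset this
  intro g _
  rcases Set.eq_empty_or_nonempty {u | ‖u‖ = 1 ∧ refl u = g} with h | ⟨v, hv⟩
  · rw [h]; exact Set.finite_empty
  · refine (Set.toFinite {v, -v}).subset ?_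
    intro u hu
    exact (refl_eq_iff hu.1 hv.1).1 (hu.2.trans hv.2.symm)

theorem neg_mem_roots {u : V} (hu : u ∈ roots G) : -u ∈ roots G :=
  ⟨by rw [norm_neg]; exact hu.1, by rw [refl_neg]; exact hu.2⟩

theorem map_mem_roots {g : O V} (hg : g ∈ G) {u : V} (hu : u ∈ roots G) : g u ∈ roots G :=
  ⟨by rw [g.norm_map]; exact hu.1, by
    rw [refl_map]; exact G.mul_mem (G.mul_mem hg hu.2) (G.inv_mem hg)⟩

theorem normalize_mem_roots {u : V} (hu : u ≠ 0) (h : refl u ∈ G) : ‖u‖⁻¹ • u ∈ roots G := by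
  have hn : ‖u‖ ≠ 0 := norm_ne_zero_iff.2 hu
  refine ⟨?_, ?_⟩
  · rw [norm_smul, norm_inv, norm_norm, inv_mul_cancel₀ hn]
  · rwa [refl_smul (inv_ne_zero hn)]

theorem notMem_mirrors_iff (x : V) : x ∉ mirrors G ↔ ∀ u ∈ roots G, inner ℝ u x ≠ 0 := by
  constructor
  · intro h u hu h0
    exact h ⟨refl u, hu.2, ⟨u, ne_zero_of_norm_eq_one hu.1, rfl⟩,
      (refl_fix_iff u x).2 h0⟩
  · rintro h ⟨g, hg, ⟨u, hu, rfl⟩, hx⟩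
    refine h _ (normalize_mem_roots hu hg) ?_
    rw [inner_smul_left, (refl_fix_iff u x).1 hx, mul_zero]

theorem closure_refl_roots (hG : IsReflectionGroup G) :
    G ≤ Subgroup.closure {g | ∃ u ∈ roots G, g = refl u} := by
  obtain ⟨S, hS, rfl⟩ := hG
  rw [Subgroup.closure_le]
  intro s hs
  obtain ⟨u, hu, rfl⟩ := hS s hs
  have hm := Subgroup.subset_closure hs
  refine Subgroup.subset_closure ⟨_, normalize_mem_roots hu hm, ?_⟩
  rw [refl_smul (inv_ne_zero (norm_ne_zero_iff.2 hu))]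

end Reflections

/-! ### Simple systems, the exchange condition and the fundamental domain -/

section SimpleSystems

variable {V : Type*} [NormedAddCommGroup V] [InnerProductSpace ℝ V]

/-- The roots of `G` on the positive side of `x₀`. -/
def posRoots (G : Subgroup (O V)) (x₀ : V) : Set V := {u | u ∈ roots G ∧ 0 < inner ℝ u x₀}

/-- `Δ` is a linearly independent set of positive roots whose cone contains all positive roots. -/
structure IsSimpleSystem (G : Subgroup (O V)) (x₀ : V) (Δ : Finset V) : Prop where
  mem_posRoots : ∀ a ∈ Δ, a ∈ posRoots G x₀
  exists_coeff : ∀ u ∈ posRoots G x₀, ∃ c : V → ℝ, (∀ a ∈ Δ, 0 ≤ c a) ∧ u = ∑ a ∈ Δ, c a • a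
  coeff_eq_zero : ∀ c : V → ℝ, ∑ a ∈ Δ, c a • a = 0 → ∀ a ∈ Δ, c a = 0

variable {G : Subgroup (O V)} {x₀ : V} {Δ : Finset V}

theorem mem_posRoots_or_neg (hx₀ : x₀ ∉ mirrors G) {u : V} (hu : u ∈ roots G) :
    u ∈ posRoots G x₀ ∨ -u ∈ posRoots G x₀ := by
  rcases lt_or_gt_of_ne ((notMem_mirrors_iff x₀).1 hx₀ u hu) with h | h
  · right; exact ⟨neg_mem_roots hu, by rw [inner_neg_left]; linarith⟩
  · left; exact ⟨hu, h⟩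

/-- A family of positive vectors with pairwise nonpositive inner products is independent. -/
theorem coeff_eq_zero_of_obtuse (hpos : ∀ a ∈ Δ, 0 < inner ℝ a x₀)
    (hob : ∀ a ∈ Δ, ∀ b ∈ Δ, a ≠ b → inner ℝ a b ≤ 0) (c : V → ℝ)
    (hc : ∑ a ∈ Δ, c a • a = 0) : ∀ a ∈ Δ, c a = 0 := by
  have key : ∀ f : V → ℝ, (∀ a, 0 ≤ f a) → ∑ a ∈ Δ, f a • a = 0 → ∀ a ∈ Δ, f a = 0 := by
    intro f hf h a ha
    have h1 : ∑ a ∈ Δ, f a * inner ℝ a x₀ = 0 := by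
      have := congrArg (fun z => inner ℝ z x₀) h
      simpa [sum_inner, inner_smul_left] using this
    have h2 := (Finset.sum_eq_zero_iff_of_nonneg
      (fun a ha => mul_nonneg (hf a) (hpos a ha).le)).1 h1 a ha
    exact (mul_eq_zero.1 h2).resolve_right (hpos a ha).ne'
  have hpn : ∀ a, c a = (c a)⁺ - (c a)⁻ := fun a => (posPart_sub_negPart (c a)).symm
  -- The positive and the negative part of the relation are the same vector. They have disjoint
  -- supports, so obtuseness makes the inner product of this vector with itself nonpositive; pairing
  -- the zero vector with `x₀` then kills each coefficient.
  have heq : ∑ a ∈ Δ, (c a)⁺ • a = ∑ a ∈ Δ, (c a)⁻ • a := by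
    rw [← sub_eq_zero, ← Finset.sum_sub_distrib, ← hc]
    refine Finset.sum_congr rfl fun a _ => ?_
    rw [← sub_smul, ← hpn]
  have hle : inner ℝ (∑ a ∈ Δ, (c a)⁺ • a) (∑ a ∈ Δ, (c a)⁻ • a) ≤ (0 : ℝ) := by
    rw [sum_inner]
    refine Finset.sum_nonpos fun a ha => ?_
    rw [inner_sum]
    refine Finset.sum_nonpos fun b hb => ?_
    rw [inner_smul_left, inner_smul_right]
    simp only [conj_trivial]
    by_cases hab : a = b
    · subst hab
      have : (c a)⁺ * (c a)⁻ = 0 := by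
        rcases le_total 0 (c a) with h0 | h0
        · rw [negPart_eq_zero.2 h0, mul_zero]
        · rw [posPart_eq_zero.2 h0, zero_mul]
      rw [← mul_assoc, this, zero_mul]
    · exact mul_nonpos_of_nonneg_of_nonpos (posPart_nonneg _)
        (mul_nonpos_of_nonneg_of_nonpos (negPart_nonneg _) (hob a ha b hb hab))
  rw [← heq, real_inner_self_eq_norm_sq] at hle
  have h0 : ∑ a ∈ Δ, (c a)⁺ • a = 0 := by
    rw [← norm_eq_zero]
    exact pow_eq_zero_iff (two_ne_zero) |>.1 (le_antisymm hle (sq_nonneg _))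
  intro a ha
  rw [hpn a, key _ (fun a => posPart_nonneg (c a)) h0 a ha,
    key _ (fun a => negPart_nonneg (c a)) (heq ▸ h0) a ha, sub_zero]

/-- Among the finite sets of positive roots whose cone contains all positive roots, one of least
cardinality works: minimality makes its members extremal, extremality makes them pairwise obtuse,
and obtuseness makes them independent. -/
theorem exists_isSimpleSystem (hfin : Finite G) (hx₀ : x₀ ∉ mirrors G) :
    ∃ Δ : Finset V, IsSimpleSystem G x₀ Δ := by
  classical
  have hpf : (posRoots G x₀).Finite := (roots_finite hfin).subset fun u hu => hu.1
  let P : Finset V → Prop := fun Δ => (∀ a ∈ Δ, a ∈ posRoots G x₀) ∧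
    ∀ u ∈ posRoots G x₀, ∃ c : V → ℝ, (∀ a ∈ Δ, 0 ≤ c a) ∧ u = ∑ a ∈ Δ, c a • a
  have hP : ∃ Δ, P Δ := by
    refine ⟨hpf.toFinset, fun a ha => hpf.mem_toFinset.1 ha, fun u hu => ?_⟩
    refine ⟨fun a => if a = u then 1 else 0, fun a _ => by positivity, ?_⟩
    simp [ite_smul, Finset.sum_ite_eq', hu]
  obtain ⟨Δ, hΔ, hmin⟩ : ∃ Δ, P Δ ∧ ∀ Δ', P Δ' → Δ.card ≤ Δ'.card := by
    have hne : {Δ | P Δ}.Nonempty := hP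
    obtain ⟨Δ, hΔ, hm⟩ := (measure (Finset.card (α := V))).wf.has_min _ hne
    exact ⟨Δ, hΔ, fun Δ' h => not_lt.1 (hm Δ' h)⟩
  obtain ⟨hsub, hcone⟩ := hΔ
  -- Extremality: a nonnegative expression of `β` involves `β` alone. If `c β < 1`, then `β` could
  -- be solved for and dropped from `Δ`; if `c β ≥ 1`, pairing with `x₀` makes the other terms
  -- vanish.
  have hM : ∀ β ∈ Δ, ∀ c : V → ℝ, (∀ a ∈ Δ, 0 ≤ c a) → β = ∑ a ∈ Δ, c a • a →
      ∀ a ∈ Δ, a ≠ β → c a = 0 := by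
    intro β hβ c hc hsum
    have hsum' : (1 - c β) • β = ∑ a ∈ Δ.erase β, c a • a := by
      rw [← Finset.add_sum_erase _ _ hβ] at hsum
      rw [sub_smul, one_smul]
      nth_rewrite 1 [hsum]
      abel
    rcases lt_or_ge (c β) 1 with h1 | h1
    · exfalso
      have hβ' : β = ∑ a ∈ Δ.erase β, ((1 - c β)⁻¹ * c a) • a := by
        simp only [mul_smul]
        rw [← Finset.smul_sum, ← hsum', smul_smul, inv_mul_cancel₀ (by linarith), one_smul]
      have : P (Δ.erase β) := by
        refine ⟨fun a ha => hsub a (Finset.mem_of_mem_erase ha), fun u hu => ?_⟩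
        obtain ⟨f, hf, hfu⟩ := hcone u hu
        refine ⟨fun a => f a + f β * ((1 - c β)⁻¹ * c a), fun a ha => ?_, ?_⟩
        · have h2 := hf a (Finset.mem_of_mem_erase ha)
          have h3 := hc a (Finset.mem_of_mem_erase ha)
          have h4 := hf β hβ
          have h5 : 0 ≤ (1 - c β)⁻¹ := inv_nonneg.2 (by linarith)
          positivity
        · rw [hfu, ← Finset.add_sum_erase _ _ hβ]
          nth_rewrite 2 [hβ']
          rw [Finset.smul_sum, ← Finset.sum_add_distrib]
          refine Finset.sum_congr rfl fun a _ => ?_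
          rw [add_smul, mul_smul (f β), add_comm]
      have := hmin _ this
      have := Finset.card_erase_lt_of_mem hβ
      omega
    · have h2 : ∑ a ∈ Δ.erase β, c a * inner ℝ a x₀ = (1 - c β) * inner ℝ β x₀ := by
        have := congrArg (fun z => inner ℝ z x₀) hsum'
        simpa [sum_inner, inner_smul_left] using this.symm
      have hnn : ∀ a ∈ Δ.erase β, 0 ≤ c a * inner ℝ a x₀ := fun a ha =>
        mul_nonneg (hc a (Finset.mem_of_mem_erase ha)) (hsub a (Finset.mem_of_mem_erase ha)).2.le
      have h3 : ∑ a ∈ Δ.erase β, c a * inner ℝ a x₀ = 0 := by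
        refine le_antisymm ?_ (Finset.sum_nonneg hnn)
        rw [h2]
        exact mul_nonpos_of_nonpos_of_nonneg (by linarith) (hsub β hβ).2.le
      intro a ha hab
      have h4 := (Finset.sum_eq_zero_iff_of_nonneg hnn).1 h3 a (Finset.mem_erase.2 ⟨hab, ha⟩)
      exact (mul_eq_zero.1 h4).resolve_right (hsub a ha).2.ne'
  -- If `k = 2⟨α, β⟩ > 0`, then `β - k • α` or its negative lies in the cone. This expresses `β`
  -- with a positive coefficient at `α`, or `α` with one at `β`, against extremality.
  have hob : ∀ a ∈ Δ, ∀ b ∈ Δ, a ≠ b → inner ℝ a b ≤ (0 : ℝ) := by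
    intro α hα β hβ hab
    by_contra! hlt
    have hr : refl α β ∈ roots G := map_mem_roots (hsub α hα).1.2 (hsub β hβ).1
    have hre := refl_apply_of_norm (hsub α hα).1.1 β
    set k : ℝ := 2 * inner ℝ α β with hk
    have hk0 : 0 < k := by linarith
    rcases mem_posRoots_or_neg hx₀ hr with h | h
    · obtain ⟨c, hc, hs⟩ := hcone _ h
      have : β = ∑ a ∈ Δ, (c a + if a = α then k else 0) • a := by
        simp only [add_smul, Finset.sum_add_distrib, ← hs, ite_smul, zero_smul]
        rw [Finset.sum_ite_eq' Δ α, if_pos hα, hre]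
        abel
      have h2 := hM β hβ _ (fun a ha => add_nonneg (hc a ha) (by split_ifs <;> linarith))
        this α hα hab
      simp only [if_true] at h2
      linarith [hc α hα]
    · obtain ⟨c, hc, hs⟩ := hcone _ h
      have : α = ∑ a ∈ Δ, (k⁻¹ * (c a + if a = β then 1 else 0)) • a := by
        simp only [mul_smul]
        rw [← Finset.smul_sum]
        simp only [add_smul, Finset.sum_add_distrib, ← hs, ite_smul, zero_smul, one_smul]
        rw [Finset.sum_ite_eq' Δ β, if_pos hβ, hre, neg_sub, sub_add_cancel, smul_smul,
          inv_mul_cancel₀ hk0.ne', one_smul]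
      have h2 := hM α hα _ (fun a ha => mul_nonneg (inv_nonneg.2 hk0.le)
        (add_nonneg (hc a ha) (by split_ifs <;> norm_num))) this β hβ (Ne.symm hab)
      simp only [if_true] at h2
      have h3 := (mul_eq_zero.1 h2).resolve_left (inv_ne_zero hk0.ne')
      linarith [hc β hβ]
  exact ⟨Δ, hsub, hcone, coeff_eq_zero_of_obtuse (fun a ha => (hsub a ha).2) hob⟩

namespace IsSimpleSystem

theorem coeff_unique (h : IsSimpleSystem G x₀ Δ) {c c' : V → ℝ}
    (hs : ∑ a ∈ Δ, c a • a = ∑ a ∈ Δ, c' a • a) : ∀ a ∈ Δ, c a = c' a := by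
  intro a ha
  refine sub_eq_zero.1 (h.coeff_eq_zero (fun a => c a - c' a) ?_ a ha)
  simp only [sub_smul, Finset.sum_sub_distrib, hs, sub_self]

theorem nonneg_or_nonpos (h : IsSimpleSystem G x₀ Δ) (hx₀ : x₀ ∉ mirrors G) {c : V → ℝ}
    (hr : ∑ a ∈ Δ, c a • a ∈ roots G) : (∀ a ∈ Δ, 0 ≤ c a) ∨ ∀ a ∈ Δ, c a ≤ 0 := by
  rcases mem_posRoots_or_neg hx₀ hr with h1 | h1
  · obtain ⟨c', hc', hs⟩ := h.exists_coeff _ h1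
    left; intro a ha
    rw [h.coeff_unique hs a ha]; exact hc' a ha
  · obtain ⟨c', hc', hs⟩ := h.exists_coeff _ h1
    right; intro a ha
    rw [← Finset.sum_neg_distrib] at hs
    have := h.coeff_unique (c := fun a => -c a) (by simpa only [neg_smul] using hs) a ha
    have h2 := hc' a ha
    linarith

theorem refl_eq_sum [DecidableEq V] (h : IsSimpleSystem G x₀ Δ) {α : V} (hα : α ∈ Δ)
    (c : V → ℝ) :
    refl α (∑ a ∈ Δ, c a • a) =
      ∑ a ∈ Δ, (c a - if a = α then 2 * inner ℝ α (∑ a ∈ Δ, c a • a) else 0) • a := by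
  rw [refl_apply_of_norm (h.mem_posRoots α hα).1.1]
  simp only [sub_smul, Finset.sum_sub_distrib, ite_smul, zero_smul]
  rw [Finset.sum_ite_eq' Δ α, if_pos hα]

/-- The root `u` has a positive coefficient at a simple root other than `α`, and `refl α` changes
only the coefficient at `α`. Since the coefficients of a root do not have mixed signs, the image
stays positive. -/
theorem refl_mem_posRoots (h : IsSimpleSystem G x₀ Δ) (hx₀ : x₀ ∉ mirrors G) {α u : V}
    (hα : α ∈ Δ) (hu : u ∈ posRoots G x₀) (hne : u ≠ α) : refl α u ∈ posRoots G x₀ := by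
  classical
  obtain ⟨c, hc, hs⟩ := h.exists_coeff u hu
  have hαr := h.mem_posRoots α hα
  obtain ⟨γ, hγ, hγα, hγ0⟩ : ∃ γ ∈ Δ, γ ≠ α ∧ 0 < c γ := by
    by_contra! hcon
    have h1 : u = c α • α := by
      rw [hs, Finset.sum_eq_single_of_mem α hα]
      intro b hb hbα
      rw [le_antisymm (hcon b hb hbα) (hc b hb), zero_smul]
    have h2 := congrArg norm h1
    rw [norm_smul, hαr.1.1, hu.1.1, mul_one, Real.norm_of_nonneg (hc α hα)] at h2
    rw [← h2, one_smul] at h1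
    exact hne h1
  have hr : refl α u ∈ roots G := map_mem_roots hαr.1.2 hu.1
  have he := h.refl_eq_sum hα c
  rw [← hs] at he
  have hnn := (h.nonneg_or_nonpos hx₀ (he ▸ hr)).resolve_right (by
    intro hcon
    have := hcon γ hγ
    rw [if_neg hγα] at this
    linarith)
  rcases mem_posRoots_or_neg hx₀ hr with h1 | h1
  · exact h1
  · exfalso
    have h2 := h1.2
    rw [inner_neg_left, he, sum_inner] at h2
    have : 0 ≤ ∑ i ∈ Δ, inner ℝ ((c i - if i = α then 2 * inner ℝ α u else 0) • i) x₀ := by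
      refine Finset.sum_nonneg fun a ha => ?_
      rw [inner_smul_left]
      exact mul_nonneg (by simpa using hnn a ha) (h.mem_posRoots a ha).2.le
    linarith

theorem inner_nonpos (h : IsSimpleSystem G x₀ Δ) (hx₀ : x₀ ∉ mirrors G) {α β : V}
    (hα : α ∈ Δ) (hβ : β ∈ Δ) (hne : α ≠ β) : inner ℝ α β ≤ (0 : ℝ) := by
  classical
  have hβs : β = ∑ a ∈ Δ, (if a = β then (1 : ℝ) else 0) • a := by
    simp [ite_smul, hβ]
  have he := h.refl_eq_sum hα (fun a => if a = β then (1 : ℝ) else 0)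
  rw [← hβs] at he
  have hr : refl α β ∈ roots G := map_mem_roots (h.mem_posRoots α hα).1.2 (h.mem_posRoots β hβ).1
  have hnn := (h.nonneg_or_nonpos hx₀ (he ▸ hr)).resolve_right (by
    intro hcon
    have := hcon β hβ
    rw [if_neg hne.symm, if_pos rfl] at this
    linarith)
  have := hnn α hα
  rw [if_neg hne, if_pos rfl] at this
  linarith

/-- Distinct simple roots are orthogonal or enclose an angle of at least `2π/3`. -/
theorem inner_eq_zero_or_le (h : IsSimpleSystem G x₀ Δ) (hx₀ : x₀ ∉ mirrors G) {α β : V}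
    (hα : α ∈ Δ) (hβ : β ∈ Δ) (hne : α ≠ β) :
    inner ℝ α β = (0 : ℝ) ∨ inner ℝ α β ≤ (-(1 / 2) : ℝ) := by
  classical
  by_contra! hcon
  obtain ⟨h0, h1⟩ := hcon
  have h2 := lt_of_le_of_ne (h.inner_nonpos hx₀ hα hβ hne) h0
  have hαr := (h.mem_posRoots α hα).1
  have hβr := (h.mem_posRoots β hβ).1
  have hr : refl β (refl α β) ∈ roots G := map_mem_roots hβr.2 (map_mem_roots hαr.2 hβr)
  set p : ℝ := inner ℝ α β with hp
  have hp' : inner ℝ β α = p := real_inner_comm _ _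
  -- This root is `(4p² - 1) • β - 2p • α`. For `-1/2 < p < 0` its coefficients have opposite signs,
  -- which no root allows.
  have hs : refl β (refl α β) =
      ∑ a ∈ Δ, ((if a = β then 4 * p ^ 2 - 1 else 0) + if a = α then -(2 * p) else 0) • a := by
    simp only [add_smul, Finset.sum_add_distrib, ite_smul, zero_smul]
    rw [Finset.sum_ite_eq' Δ α, Finset.sum_ite_eq' Δ β, if_pos hα, if_pos hβ,
      refl_apply_of_norm hαr.1, ← hp, map_sub, map_smul, refl_self,
      refl_apply_of_norm hβr.1, hp']
    module
  rw [hs] at hr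
  rcases h.nonneg_or_nonpos hx₀ hr with h3 | h3
  · have := h3 β hβ
    rw [if_pos rfl, if_neg hne.symm] at this
    nlinarith
  · have := h3 α hα
    rw [if_pos rfl, if_neg hne] at this
    linarith

/-- Descent on `⟨u, x₀⟩`: because `⟨u, u⟩ > 0`, a counterexample `u` has positive inner product with
some simple `α`, and `refl α u` is then a positive root of smaller height and again a
counterexample. -/
theorem refl_mem_closure (h : IsSimpleSystem G x₀ Δ) (hfin : Finite G) (hx₀ : x₀ ∉ mirrors G) :
    ∀ u ∈ posRoots G x₀, refl u ∈ Subgroup.closure (refl '' (Δ : Set V)) := by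
  classical
  have hpf : (posRoots G x₀).Finite := (roots_finite hfin).subset fun u hu => hu.1
  by_contra! hcon
  obtain ⟨u, ⟨hu, hun⟩, hmin⟩ := Set.exists_min_image
    {u | u ∈ posRoots G x₀ ∧ refl u ∉ Subgroup.closure (refl '' (Δ : Set V))}
    (fun u => inner ℝ u x₀) (hpf.subset fun u hu => hu.1) hcon
  obtain ⟨c, hc, hs⟩ := h.exists_coeff u hu
  obtain ⟨α, hα, hpos⟩ : ∃ α ∈ Δ, 0 < (inner ℝ α u : ℝ) := by
    by_contra! hno
    have h1 : inner ℝ u u = (1 : ℝ) := by rw [real_inner_self_eq_norm_sq, hu.1.1, one_pow]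
    have h2 : inner ℝ u u ≤ (0 : ℝ) := by
      nth_rewrite 1 [hs]
      rw [sum_inner]
      refine Finset.sum_nonpos fun a ha => ?_
      rw [inner_smul_left]
      exact mul_nonpos_of_nonneg_of_nonpos (by simpa using hc a ha) (hno a ha)
    linarith
  have hαm : refl α ∈ Subgroup.closure (refl '' (Δ : Set V)) :=
    Subgroup.subset_closure ⟨α, hα, rfl⟩
  have hne : u ≠ α := by rintro rfl; exact hun hαm
  have hv := h.refl_mem_posRoots hx₀ hα hu hne
  have hvn : refl (refl α u) ∉ Subgroup.closure (refl '' (Δ : Set V)) := by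
    intro hcl
    rw [refl_map] at hcl
    refine hun ?_
    have := mul_mem (mul_mem (inv_mem hαm) hcl) hαm
    simpa [mul_assoc] using this
  have h3 := hmin _ ⟨hv, hvn⟩
  rw [refl_apply_of_norm (h.mem_posRoots α hα).1.1, inner_sub_left, inner_smul_left] at h3
  have h4 := (h.mem_posRoots α hα).2
  simp only [conj_trivial] at h3
  nlinarith [mul_pos hpos h4]

theorem exists_list (h : IsSimpleSystem G x₀ Δ) (hfin : Finite G) (hx₀ : x₀ ∉ mirrors G)
    (hG : IsReflectionGroup G) {g : O V} (hg : g ∈ G) :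
    ∃ L : List V, (∀ a ∈ L, a ∈ Δ) ∧ (L.map refl).prod = g := by
  have hle : G ≤ Subgroup.closure (refl '' (Δ : Set V)) := by
    refine (closure_refl_roots hG).trans ?_
    rw [Subgroup.closure_le]
    rintro _ ⟨u, hu, rfl⟩
    rcases mem_posRoots_or_neg hx₀ hu with h1 | h1
    · exact h.refl_mem_closure hfin hx₀ u h1
    · rw [← refl_neg]; exact h.refl_mem_closure hfin hx₀ _ h1
  have hgc := hle hg
  clear hg
  induction hgc using Subgroup.closure_induction with
  | mem x hx =>
    obtain ⟨a, ha, rfl⟩ := hx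
    exact ⟨[a], by simpa using ha, by simp⟩
  | one => exact ⟨[], by simp, by simp⟩
  | mul x y _ _ hx hy =>
    obtain ⟨L, hL, rfl⟩ := hx
    obtain ⟨L', hL', rfl⟩ := hy
    refine ⟨L ++ L', fun a ha => ?_, by simp⟩
    rcases List.mem_append.1 ha with h1 | h1
    · exact hL a h1
    · exact hL' a h1
  | inv x _ hx =>
    obtain ⟨L, hL, rfl⟩ := hx
    refine ⟨L.reverse, fun a ha => hL a (List.mem_reverse.1 ha), ?_⟩
    rw [List.prod_inv_reverse, List.map_reverse, List.map_map]
    congr 2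

/-- The exchange condition. -/
theorem exchange (h : IsSimpleSystem G x₀ Δ) (hx₀ : x₀ ∉ mirrors G) {α : V} (hα : α ∈ Δ)
    (L : List V) (hL : ∀ a ∈ L, a ∈ Δ) (hneg : (L.map refl).prod α ∉ posRoots G x₀) :
    ∃ L' : List V, (∀ a ∈ L', a ∈ Δ) ∧ L'.length + 1 = L.length ∧
      (L'.map refl).prod = (L.map refl).prod * refl α := by
  induction L with
  | nil => exact absurd (h.mem_posRoots α hα) hneg
  | cons s L ih =>
    have hs : s ∈ Δ := hL s (by simp)
    have hL0 : ∀ a ∈ L, a ∈ Δ := fun a ha => hL a (by simp [ha])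
    simp only [List.map_cons, List.prod_cons] at hneg ⊢
    by_cases hc : (L.map refl).prod α ∈ posRoots G x₀
    -- The only positive root that `refl s` makes negative is `s`, so `α` has been carried to `s` at
    -- this point. Then `refl s` is the conjugate of `refl α` by the rest of the word, and
    -- multiplying by `refl α` deletes the letter `s`.
    · have he : (L.map refl).prod α = s := by
        by_contra hne
        exact hneg (h.refl_mem_posRoots hx₀ hs hc hne)
      refine ⟨L, hL0, by simp, ?_⟩
      have h1 := refl_map (L.map refl).prod α
      rw [he] at h1
      rw [h1]
      simp only [mul_assoc, inv_mul_cancel_left, refl_mul_self, mul_one]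
    · obtain ⟨L', hL', hlen, hp⟩ := ih hL0 hc
      refine ⟨s :: L', ?_, by simp [hlen], ?_⟩
      · intro a ha
        rcases List.mem_cons.1 ha with rfl | ha
        · exact hs
        · exact hL' a ha
      · simp only [List.map_cons, List.prod_cons, hp, mul_assoc]

/-- If the word ends in `α`, then the rest of it must send `α` to a negative root, since the whole
word keeps `α` positive. The exchange condition rewrites the element by a word shorter by two
letters. -/
theorem prod_eq_one (h : IsSimpleSystem G x₀ Δ) (hx₀ : x₀ ∉ mirrors G) (n : ℕ) :
    ∀ L : List V, L.length = n → (∀ a ∈ L, a ∈ Δ) →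
      (∀ u ∈ posRoots G x₀, (L.map refl).prod u ∈ posRoots G x₀) → (L.map refl).prod = 1 := by
  induction n using Nat.strong_induction_on with
  | _ n ih =>
    intro L hlen hL hpos
    rcases List.eq_nil_or_concat L with rfl | ⟨L₀, α, hLα⟩
    · simp
    rw [List.concat_eq_append] at hLα
    subst hLα
    have hα : α ∈ Δ := hL α (by simp)
    have hprod : ((L₀ ++ [α]).map refl).prod = (L₀.map refl).prod * refl α := by simp
    have hneg : (L₀.map refl).prod α ∉ posRoots G x₀ := by
      intro hc
      have h1 := (hpos α (h.mem_posRoots α hα)).2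
      rw [hprod] at h1
      change 0 < inner ℝ ((L₀.map refl).prod (refl α α)) x₀ at h1
      rw [refl_self, map_neg, inner_neg_left] at h1
      linarith [hc.2]
    obtain ⟨L', hL', hlen', hp⟩ := h.exchange hx₀ hα L₀ (fun a ha => hL a (by simp [ha])) hneg
    rw [hprod, ← hp] at hpos ⊢
    refine ih L'.length ?_ L' rfl hL' hpos
    simp at hlen
    omega

end IsSimpleSystem

/-- `G` acts freely on chambers. -/
theorem eq_one_of_map_posRoots (hfin : Finite G) (hG : IsReflectionGroup G)
    (hx₀ : x₀ ∉ mirrors G) {g : O V} (hg : g ∈ G)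
    (h : ∀ u ∈ posRoots G x₀, g u ∈ posRoots G x₀) : g = 1 := by
  obtain ⟨Δ, hΔ⟩ := exists_isSimpleSystem hfin hx₀
  obtain ⟨L, hL, rfl⟩ := hΔ.exists_list hfin hx₀ hG hg
  exact hΔ.prod_eq_one hx₀ _ L rfl hL h

/-- The closed chamber containing `x₀`. -/
def closedChamber (G : Subgroup (O V)) (x₀ : V) : Set V :=
  {x | ∀ u ∈ posRoots G x₀, 0 ≤ inner ℝ u x}

/-- A maximizer `m` of `⟨m x, y⟩` must be the identity once ties are broken suitably: if `m⁻¹` made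
a positive root `u` negative, composing with `refl u` would improve `m`, and an element that
preserves the positive roots is trivial. -/
theorem inner_map_le (hfin : Finite G) (hG : IsReflectionGroup G)
    (hx₀ : x₀ ∉ mirrors G) {x y : V} (hx : x ∈ closedChamber G x₀) (hy : y ∈ closedChamber G x₀)
    {g : O V} (hg : g ∈ G) : inner ℝ (g x) y ≤ (inner ℝ x y : ℝ) := by
  -- When `x` or `y` lies on a mirror, the first coordinate may have several maximizers; the second,
  -- at the regular point `x₀`, increases strictly under the improving reflection.
  obtain ⟨⟨m, hm⟩, hmax⟩ := Finite.exists_max (fun g : G =>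
    toLex ((inner ℝ ((g : O V) x) y : ℝ), (inner ℝ ((g : O V) x₀) x₀ : ℝ)))
  have hinv : m⁻¹ = 1 := by
    refine eq_one_of_map_posRoots hfin hG hx₀ (G.inv_mem hm) fun u hu => ?_
    refine ⟨map_mem_roots (G.inv_mem hm) hu.1, ?_⟩
    by_contra! hcon
    rw [inner_map_left, inv_inv] at hcon
    have hne : inner ℝ u (m x₀) ≠ (0 : ℝ) := by
      rw [inner_map_right]
      exact (notMem_mirrors_iff x₀).1 hx₀ _ (map_mem_roots (G.inv_mem hm) hu.1)
    have hlt := lt_of_le_of_ne hcon hne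
    have hle := hmax ⟨refl u * m, G.mul_mem hu.1.2 hm⟩
    have hux : inner ℝ u (m x) ≤ (0 : ℝ) := by
      have hr : -(m⁻¹ u) ∈ posRoots G x₀ := by
        refine ⟨neg_mem_roots (map_mem_roots (G.inv_mem hm) hu.1), ?_⟩
        rw [inner_neg_left, inner_map_left, inv_inv]; linarith
      have := hx _ hr
      rw [inner_neg_left, inner_map_left, inv_inv] at this
      linarith
    have huy := hy u hu
    have e1 : (inner ℝ ((refl u * m) x) y : ℝ) =
        inner ℝ (m x) y - 2 * inner ℝ u (m x) * inner ℝ u y := by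
      change inner ℝ (refl u (m x)) y = _
      rw [refl_apply_of_norm hu.1.1, inner_sub_left, inner_smul_left]; simp
    have e2 : (inner ℝ ((refl u * m) x₀) x₀ : ℝ) =
        inner ℝ (m x₀) x₀ - 2 * inner ℝ u (m x₀) * inner ℝ u x₀ := by
      change inner ℝ (refl u (m x₀)) x₀ = _
      rw [refl_apply_of_norm hu.1.1, inner_sub_left, inner_smul_left]; simp
    rw [Prod.Lex.toLex_le_toLex] at hle
    simp only [e1, e2] at hle
    have h1 : inner ℝ u (m x) * inner ℝ u y ≤ (0 : ℝ) :=
      mul_nonpos_of_nonpos_of_nonneg hux huy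
    have h2 : inner ℝ u (m x₀) * inner ℝ u x₀ < (0 : ℝ) := mul_neg_of_neg_of_pos hlt hu.2
    rcases hle with h3 | h3
    · linarith
    · linarith [h3.2]
  have hm1 : m = 1 := inv_eq_one.1 hinv
  subst hm1
  have := hmax ⟨g, hg⟩
  rw [Prod.Lex.toLex_le_toLex] at this
  rcases this with h3 | h3
  · exact h3.le
  · exact h3.1.le

/-- The orbit point with the largest inner product with `x₀` works: if a positive root were negative
on it, reflecting would increase that inner product. -/
theorem exists_map_mem_closedChamber (hfin : Finite G) (x₀ : V) (x : V) :
    ∃ g ∈ G, g x ∈ closedChamber G x₀ := by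
  obtain ⟨⟨m, hm⟩, hmax⟩ := Finite.exists_max (fun g : G => (inner ℝ ((g : O V) x) x₀ : ℝ))
  refine ⟨m, hm, fun u hu => ?_⟩
  have hle := hmax ⟨refl u * m, G.mul_mem hu.1.2 hm⟩
  change inner ℝ (refl u (m x)) x₀ ≤ inner ℝ (m x) x₀ at hle
  rw [refl_apply_of_norm hu.1.1, inner_sub_left, inner_smul_left] at hle
  simp only [conj_trivial] at hle
  by_contra! hlt
  nlinarith [mul_neg_of_neg_of_pos hlt hu.2]

end SimpleSystems

/-! ### Weyl chambers, their walls and fundamental systems -/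

section Chambers

variable {V : Type*} [NormedAddCommGroup V] [InnerProductSpace ℝ V]
  {G : Subgroup (O V)} {x₀ : V} {Δ : Finset V}

/-- The open chamber containing `x₀`. -/
def openChamber (G : Subgroup (O V)) (x₀ : V) : Set V :=
  {x | ∀ u ∈ posRoots G x₀, 0 < inner ℝ u x}

theorem mem_openChamber_self : x₀ ∈ openChamber G x₀ := fun _ hu => hu.2

theorem openChamber_subset (hx₀ : x₀ ∉ mirrors G) : openChamber G x₀ ⊆ (mirrors G)ᶜ := by
  intro x hx
  refine (notMem_mirrors_iff x).2 fun u hu => ?_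
  rcases mem_posRoots_or_neg hx₀ hu with h | h
  · exact (hx u h).ne'
  · have := hx _ h
    rw [inner_neg_left] at this
    linarith

theorem convex_openChamber : Convex ℝ (openChamber G x₀) := by
  intro x hx y hy a b ha hb hab u hu
  rw [inner_add_right, inner_smul_right, inner_smul_right]
  rcases ha.eq_or_lt with rfl | ha
  · rw [zero_add] at hab
    subst hab
    simpa using hy u hu
  · exact add_pos_of_pos_of_nonneg (mul_pos ha (hx u hu)) (mul_nonneg hb (hy u hu).le)

/-- A root has no zero off the mirrors, so by the intermediate value theorem it keeps its sign on a
component; conversely the open chamber is convex and avoids the mirrors. -/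
theorem connectedComponentIn_mirrors_compl (hx₀ : x₀ ∉ mirrors G) :
    connectedComponentIn (mirrors G)ᶜ x₀ = openChamber G x₀ := by
  apply subset_antisymm
  · intro y hy u hu
    by_contra! hle
    have hc : Continuous fun z : V => (inner ℝ u z : ℝ) := by fun_prop
    have hp := (isPreconnected_connectedComponentIn (F := (mirrors G)ᶜ) (x := x₀)).image
      (fun z => (inner ℝ u z : ℝ)) hc.continuousOn
    have h0 := hp.ordConnected.out ⟨y, hy, rfl⟩ ⟨x₀, mem_connectedComponentIn hx₀, rfl⟩
      ⟨hle, hu.2.le⟩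
    obtain ⟨z, hz, hz0⟩ := h0
    exact (notMem_mirrors_iff z).1 (connectedComponentIn_subset _ _ hz) u hu.1 hz0
  · exact convex_openChamber.isPreconnected.subset_connectedComponentIn mem_openChamber_self
      (openChamber_subset hx₀)

theorem isOpen_openChamber (hfin : Finite G) : IsOpen (openChamber G x₀) := by
  have hpf : (posRoots G x₀).Finite := (roots_finite hfin).subset fun u hu => hu.1
  have : openChamber G x₀ = ⋂ u ∈ posRoots G x₀, {x | 0 < (inner ℝ u x : ℝ)} := by
    ext x; simp [openChamber]
  rw [this]
  exact hpf.isOpen_biInter fun u _ => isOpen_lt continuous_const (by fun_prop)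

theorem isClosed_closedChamber : IsClosed (closedChamber G x₀) := by
  have : closedChamber G x₀ = ⋂ u ∈ posRoots G x₀, {x | 0 ≤ (inner ℝ u x : ℝ)} := by
    ext x; simp [closedChamber]
  rw [this]
  exact isClosed_biInter fun u _ => isClosed_le continuous_const (by fun_prop)

theorem openChamber_subset_closedChamber : openChamber G x₀ ⊆ closedChamber G x₀ :=
  fun _ hx u hu => (hx u hu).le

theorem closure_openChamber : closure (openChamber G x₀) = closedChamber G x₀ := by
  apply subset_antisymm
  · exact isClosed_closedChamber.closure_subset_iff.2 openChamber_subset_closedChamber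
  · intro x hx
    have ht : Filter.Tendsto (fun t : ℝ => x + t • x₀) (nhdsWithin 0 (Set.Ioi 0)) (nhds x) := by
      have : Continuous fun t : ℝ => x + t • x₀ := by fun_prop
      have h := this.tendsto 0
      simp only [zero_smul, add_zero] at h
      exact h.mono_left nhdsWithin_le_nhds
    refine mem_closure_of_tendsto ht ?_
    filter_upwards [self_mem_nhdsWithin] with t ht u hu
    rw [inner_add_right, inner_smul_right]
    exact add_pos_of_nonneg_of_pos (hx u hu) (mul_pos ht hu.2)

theorem mem_frontier_openChamber (hfin : Finite G) (x : V) :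
    x ∈ frontier (openChamber G x₀) ↔
      x ∈ closedChamber G x₀ ∧ ∃ u ∈ posRoots G x₀, inner ℝ u x = (0 : ℝ) := by
  rw [(isOpen_openChamber hfin).frontier_eq, closure_openChamber]
  constructor
  · rintro ⟨h1, h2⟩
    refine ⟨h1, ?_⟩
    by_contra! hcon
    exact h2 fun u hu => lt_of_le_of_ne (h1 u hu) (hcon u hu).symm
  · rintro ⟨h1, u, hu, h0⟩
    exact ⟨h1, fun h2 => (h2 u hu).ne' h0⟩

namespace IsSimpleSystem

theorem linearIndepOn (h : IsSimpleSystem G x₀ Δ) : LinearIndepOn ℝ id (Δ : Set V) := by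
  rw [linearIndepOn_finset_iff]
  exact h.coeff_eq_zero

theorem mem_closedChamber_iff (h : IsSimpleSystem G x₀ Δ) (x : V) :
    x ∈ closedChamber G x₀ ↔ ∀ a ∈ Δ, 0 ≤ (inner ℝ a x : ℝ) := by
  refine ⟨fun hx a ha => hx a (h.mem_posRoots a ha), fun hx u hu => ?_⟩
  obtain ⟨c, hc, rfl⟩ := h.exists_coeff u hu
  rw [sum_inner]
  refine Finset.sum_nonneg fun a ha => ?_
  rw [inner_smul_left]
  exact mul_nonneg (by simpa using hc a ha) (hx a ha)

theorem exists_inner_eq [FiniteDimensional ℝ V] (h : IsSimpleSystem G x₀ Δ) (f : V → ℝ) :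
    ∃ y, ∀ a ∈ Δ, inner ℝ a y = f a := by
  have hli := h.linearIndepOn
  let b := Module.Basis.extend hli
  let φ : V →ₗ[ℝ] ℝ := b.constr ℝ fun i => f i
  refine ⟨(InnerProductSpace.toDual ℝ V).symm (LinearMap.toContinuousLinearMap φ), fun a ha => ?_⟩
  rw [real_inner_comm, InnerProductSpace.toDual_symm_apply]
  have hb : b ⟨a, hli.subset_extend (Set.subset_univ _) ha⟩ = a := Module.Basis.extend_apply_self hli _
  change φ a = f a
  conv_lhs => rw [← hb]
  exact b.constr_basis ℝ _ _

/-- Each wall of the chamber has a point that lies on no other mirror. -/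
theorem exists_mem_wall [FiniteDimensional ℝ V] (h : IsSimpleSystem G x₀ Δ) {δ : V}
    (hδ : δ ∈ Δ) :
    ∃ y, inner ℝ δ y = (0 : ℝ) ∧ ∀ u ∈ posRoots G x₀, u ≠ δ → 0 < (inner ℝ u y : ℝ) := by
  classical
  -- A positive root that vanishes at this `y` has coefficient zero at every simple root but `δ`,
  -- and so is `δ`.
  obtain ⟨y, hy⟩ := h.exists_inner_eq fun a => if a = δ then 0 else 1
  refine ⟨y, by simpa using hy δ hδ, fun u hu hne => ?_⟩
  obtain ⟨c, hc, hs⟩ := h.exists_coeff u hu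
  have hnn : ∀ a ∈ Δ, 0 ≤ (inner ℝ (c a • a) y : ℝ) := by
    intro a ha
    rw [inner_smul_left, hy a ha]
    exact mul_nonneg (by simpa using hc a ha) (by split_ifs <;> norm_num)
  have hge : 0 ≤ (inner ℝ u y : ℝ) := by
    rw [hs, sum_inner]; exact Finset.sum_nonneg hnn
  refine lt_of_le_of_ne hge fun h0 => hne ?_
  rw [hs, sum_inner, eq_comm, Finset.sum_eq_zero_iff_of_nonneg hnn] at h0
  have h1 : u = c δ • δ := by
    rw [hs, Finset.sum_eq_single_of_mem δ hδ]
    intro b hb hbδ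
    have := h0 b hb
    rw [inner_smul_left, hy b hb, if_neg hbδ, mul_one] at this
    simp only [conj_trivial] at this
    rw [this, zero_smul]
  have h2 := congrArg norm h1
  rw [norm_smul, (h.mem_posRoots δ hδ).1.1, hu.1.1, mul_one, Real.norm_of_nonneg (hc δ hδ)] at h2
  rw [h1, ← h2, one_smul]

/-- Such a point forces every cover of the boundary by mirrors to use the mirror of `δ`. This both
bounds the size of covers from below and identifies the members of a fundamental system. -/
theorem exists_mem_frontier [FiniteDimensional ℝ V] (h : IsSimpleSystem G x₀ Δ)
    (hfin : Finite G) (hx₀ : x₀ ∉ mirrors G) {δ : V} (hδ : δ ∈ Δ) :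
    ∃ y ∈ frontier (openChamber G x₀), ∀ u, u ≠ 0 → refl u ∈ G → inner ℝ u y = (0 : ℝ) →
      ‖u‖⁻¹ • u = δ ∨ ‖u‖⁻¹ • u = -δ := by
  obtain ⟨y, hy0, hy⟩ := h.exists_mem_wall hδ
  refine ⟨y, (mem_frontier_openChamber hfin y).2 ⟨fun u hu => ?_, δ, h.mem_posRoots δ hδ, hy0⟩,
    fun u hu hr h0 => ?_⟩
  · by_cases hne : u = δ
    · rw [hne, hy0]
    · exact (hy u hu hne).le
  · have h1 : inner ℝ (‖u‖⁻¹ • u) y = (0 : ℝ) := by rw [inner_smul_left, h0, mul_zero]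
    rcases mem_posRoots_or_neg hx₀ (normalize_mem_roots hu hr) with hp | hp
    · left
      by_contra hne
      exact (hy _ hp hne).ne' h1
    · right
      by_contra hne
      refine (hy _ hp fun h2 => hne (neg_eq_iff_eq_neg.1 h2)).ne' ?_
      rw [inner_neg_left, h1, neg_zero]

theorem frontier_subset (h : IsSimpleSystem G x₀ Δ) (hfin : Finite G) :
    ∀ x ∈ frontier (openChamber G x₀), ∃ a ∈ Δ, inner ℝ a x = (0 : ℝ) := by
  intro x hx
  obtain ⟨hx, u, hu, h0⟩ := (mem_frontier_openChamber hfin x).1 hx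
  by_contra! hcon
  obtain ⟨c, hc, hs⟩ := h.exists_coeff u hu
  have hnn : ∀ a ∈ Δ, 0 ≤ (inner ℝ (c a • a) x : ℝ) := by
    intro a ha
    rw [inner_smul_left]
    exact mul_nonneg (by simpa using hc a ha) (hx a (h.mem_posRoots a ha))
  rw [hs, sum_inner, Finset.sum_eq_zero_iff_of_nonneg hnn] at h0
  refine ne_zero_of_norm_eq_one hu.1.1 ?_
  rw [hs]
  refine Finset.sum_eq_zero fun a ha => ?_
  have := h0 a ha
  rw [inner_smul_left] at this
  rw [show c a = 0 by simpa using (mul_eq_zero.1 this).resolve_right (hcon a ha), zero_smul]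

theorem card_le_of_cover [FiniteDimensional ℝ V] (h : IsSimpleSystem G x₀ Δ) (hfin : Finite G)
    (hx₀ : x₀ ∉ mirrors G) (S : Finset V) (hS : ∀ u ∈ S, u ≠ 0 ∧ refl u ∈ G)
    (hcov : ∀ x ∈ frontier (openChamber G x₀), ∃ u ∈ S, inner ℝ u x = (0 : ℝ)) :
    Δ.card ≤ S.card := by
  have key : ∀ δ ∈ Δ, ∃ u ∈ S, ‖u‖⁻¹ • u = δ ∨ ‖u‖⁻¹ • u = -δ := by
    intro δ hδ
    obtain ⟨y, hy, hyu⟩ := h.exists_mem_frontier hfin hx₀ hδ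
    obtain ⟨u, hu, h0⟩ := hcov y hy
    exact ⟨u, hu, hyu u (hS u hu).1 (hS u hu).2 h0⟩
  choose! f hf hfe using key
  refine Finset.card_le_card_of_injOn f (fun δ hδ => hf δ hδ) ?_
  intro a ha b hb hab
  have h1 := hfe a ha
  have h2 := hfe b hb
  rw [hab] at h1
  have ha0 := (h.mem_posRoots a ha).2
  have hb0 := (h.mem_posRoots b hb).2
  rcases h1 with h1 | h1 <;> rcases h2 with h2 | h2
  · exact h1.symm.trans h2
  · rw [h1.symm.trans h2, inner_neg_left] at ha0; linarith
  · rw [h2.symm.trans h1, inner_neg_left] at hb0; linarith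
  · exact neg_injective (h1.symm.trans h2)

theorem isFundamentalSystem [FiniteDimensional ℝ V] (h : IsSimpleSystem G x₀ Δ)
    (hfin : Finite G) (hx₀ : x₀ ∉ mirrors G) {ι : Type*} [Fintype ι] (e : ι ≃ Δ) :
    IsFundamentalSystem G fun i => (e i : V) := by
  refine ⟨openChamber G x₀, ⟨x₀, hx₀, (connectedComponentIn_mirrors_compl hx₀).symm⟩,
    fun i => (h.mem_posRoots _ (e i).2).1.1, fun i x hx => (hx _ (h.mem_posRoots _ (e i).2)).le,
    fun i => (h.mem_posRoots _ (e i).2).1.2, fun x hx => ?_, fun S hS hcov => ?_⟩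
  · obtain ⟨a, ha, h0⟩ := h.frontier_subset hfin x hx
    exact ⟨e.symm ⟨a, ha⟩, by simpa using h0⟩
  · rw [Fintype.card_congr e, Fintype.card_coe]
    exact h.card_le_of_cover hfin hx₀ S hS hcov

end IsSimpleSystem

/-- Each simple root occurs among the `α i`, since its wall has a point on no other mirror; the
minimality clause, applied to the cover by the simple roots, leaves no room for other members. -/
theorem IsFundamentalSystem.exists_isSimpleSystem [FiniteDimensional ℝ V] (hfin : Finite G)
    {ι : Type*} [Fintype ι] {α : ι → V} (hα : IsFundamentalSystem G α) :
    ∃ x₀ ∉ mirrors G, ∃ Δ : Finset V, IsSimpleSystem G x₀ Δ ∧ ∃ e : ι ≃ Δ, ∀ i, α i = e i := by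
  classical
  obtain ⟨_, ⟨x₀, hx₀, rfl⟩, hnorm, hdual, hrefl, hcov, hmin⟩ := hα
  rw [connectedComponentIn_mirrors_compl hx₀] at *
  obtain ⟨Δ, h⟩ := MaxFiltering.exists_isSimpleSystem hfin hx₀
  have hpos : ∀ i, α i ∈ posRoots G x₀ := fun i =>
    ⟨⟨hnorm i, hrefl i⟩, lt_of_le_of_ne (hdual i x₀ mem_openChamber_self)
      ((notMem_mirrors_iff x₀).1 hx₀ _ ⟨hnorm i, hrefl i⟩).symm⟩
  have hsurj : ∀ δ : Δ, ∃ i, α i = δ := by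
    rintro ⟨δ, hδ⟩
    obtain ⟨y, hy, hyu⟩ := h.exists_mem_frontier hfin hx₀ hδ
    obtain ⟨i, hi⟩ := hcov y hy
    refine ⟨i, ?_⟩
    have := hyu (α i) (ne_zero_of_norm_eq_one (hnorm i)) (hrefl i) hi
    rw [hnorm i, inv_one, one_smul] at this
    refine this.resolve_right fun hn => ?_
    have h1 := (hpos i).2
    rw [hn, inner_neg_left] at h1
    linarith [(h.mem_posRoots δ hδ).2]
  choose f hf using hsurj
  have hinj : Function.Injective f := fun a b hab => Subtype.ext (by rw [← hf a, ← hf b, hab])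
  have hle : Fintype.card ι ≤ Fintype.card Δ := by
    rw [Fintype.card_coe]
    refine hmin Δ (fun u hu => ?_) (h.frontier_subset hfin)
    have := (h.mem_posRoots u hu).1
    exact ⟨ne_zero_of_norm_eq_one this.1, this.2⟩
  have hbij : Function.Bijective f := (Fintype.bijective_iff_injective_and_card f).2
    ⟨hinj, le_antisymm (Fintype.card_le_of_injective f hinj) hle⟩
  refine ⟨x₀, hx₀, Δ, h, (Equiv.ofBijective f hbij).symm, fun i => ?_⟩
  rw [← hf]
  congr 1
  exact ((Equiv.ofBijective f hbij).apply_symm_apply i).symm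

/-- A regular point exists. -/
theorem exists_notMem_mirrors (hfin : Finite G) : ∃ x₀, x₀ ∉ mirrors G := by
  have hf := (roots_finite hfin)
  have hne : ∀ u : roots G, (LinearMap.ker (innerₛₗ ℝ (u : V))) ≠ ⊤ := by
    intro u hu
    have h1 : (u : V) ∈ LinearMap.ker (innerₛₗ ℝ (u : V)) := by rw [hu]; trivial
    rw [LinearMap.mem_ker] at h1
    exact ne_zero_of_norm_eq_one u.2.1 (inner_self_eq_zero.1 h1)
  have : Finite (roots G) := hf
  by_contra! hcon
  have hcov : ⋃ u : roots G, ((LinearMap.ker (innerₛₗ ℝ (u : V)) : Submodule ℝ V) : Set V)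
      = Set.univ := by
    refine Set.eq_univ_of_forall fun x => ?_
    have := mt (notMem_mirrors_iff (G := G) x).2 (not_not.2 (hcon x))
    push Not at this
    obtain ⟨u, hu, h0⟩ := this
    exact Set.mem_iUnion.2 ⟨⟨u, hu⟩, h0⟩
  obtain ⟨u, hu⟩ := Subspace.exists_eq_top_of_iUnion_eq_univ hcov
  exact hne u hu

theorem closure_fix {S : Set (O V)} {x : V} (hS : ∀ s ∈ S, s x = x) {g : O V}
    (hg : g ∈ Subgroup.closure S) : g x = x := by
  induction hg using Subgroup.closure_induction with
  | mem g hg => exact hS g hg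
  | one => rfl
  | mul a b _ _ ha hb =>
    change a (b x) = x
    rw [hb, ha]
  | inv a _ ha => exact (a.symm_apply_eq).2 ha.symm

/-- A vector orthogonal to the simple roots is orthogonal to all roots, hence fixed by the
generating reflections. -/
theorem span_eq_top_of_isEssential [FiniteDimensional ℝ V] (h : IsSimpleSystem G x₀ Δ)
    (hx₀ : x₀ ∉ mirrors G) (hG : IsReflectionGroup G) (hess : IsEssential G) :
    Submodule.span ℝ (Δ : Set V) = ⊤ := by
  rw [← Submodule.orthogonal_eq_bot_iff, Submodule.eq_bot_iff]
  intro x hx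
  have hΔ : ∀ a ∈ Δ, inner ℝ a x = (0 : ℝ) := fun a ha => hx a (Submodule.subset_span ha)
  have hpos : ∀ u ∈ posRoots G x₀, inner ℝ u x = (0 : ℝ) := by
    intro u hu
    obtain ⟨c, -, rfl⟩ := h.exists_coeff u hu
    rw [sum_inner]
    exact Finset.sum_eq_zero fun a ha => by rw [inner_smul_left, hΔ a ha, mul_zero]
  refine hess x fun g hg => closure_fix (fun s hs => ?_) (closure_refl_roots hG hg)
  obtain ⟨u, hu, rfl⟩ := hs
  rw [refl_fix_iff]
  rcases mem_posRoots_or_neg hx₀ hu with h1 | h1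
  · exact hpos u h1
  · have := hpos _ h1
    rwa [inner_neg_left, neg_eq_zero] at this

end Chambers

/-! ### Lipschitz bounds as frame bounds in the chamber -/

section FilterBanks

variable {V : Type*} [NormedAddCommGroup V] [InnerProductSpace ℝ V]
  {G : Subgroup (O V)} {x₀ : V}

theorem mem_orbit_self (x : V) : x ∈ orbit G x := ⟨1, G.one_mem, rfl⟩

theorem orbit_map {g : O V} (hg : g ∈ G) (x : V) : orbit G (g x) = orbit G x := by
  ext y
  constructor
  · rintro ⟨h, hh, rfl⟩
    exact ⟨h * g, G.mul_mem hh hg, rfl⟩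
  · rintro ⟨h, hh, rfl⟩
    refine ⟨h * g⁻¹, G.mul_mem hh (G.inv_mem hg), ?_⟩
    change h (g⁻¹ (g x)) = h x
    congr 1
    exact g.symm_apply_apply x

theorem maxFilter_map_left {g : O V} (hg : g ∈ G) (x y : V) :
    maxFilter G (g x) y = maxFilter G x y := by
  unfold maxFilter; rw [orbit_map hg]

theorem maxFilter_map_right {g : O V} (hg : g ∈ G) (x y : V) :
    maxFilter G x (g y) = maxFilter G x y := by
  unfold maxFilter; rw [orbit_map hg]

theorem orbitDist_map_left {g : O V} (hg : g ∈ G) (x y : V) :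
    orbitDist G (g x) y = orbitDist G x y := by
  unfold orbitDist; rw [orbit_map hg]

theorem orbitDist_map_right {g : O V} (hg : g ∈ G) (x y : V) :
    orbitDist G x (g y) = orbitDist G x y := by
  unfold orbitDist; rw [orbit_map hg]

theorem inner_orbit_le (hfin : Finite G) (hG : IsReflectionGroup G) (hx₀ : x₀ ∉ mirrors G)
    {x y p q : V} (hx : x ∈ closedChamber G x₀) (hy : y ∈ closedChamber G x₀)
    (hp : p ∈ orbit G x) (hq : q ∈ orbit G y) : inner ℝ p q ≤ (inner ℝ x y : ℝ) := by
  obtain ⟨g, hg, rfl⟩ := hp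
  obtain ⟨h, hh, rfl⟩ := hq
  rw [inner_map_right]
  exact inner_map_le hfin hG hx₀ hx hy (G.mul_mem (G.inv_mem hh) hg)

theorem maxFilter_eq_inner (hfin : Finite G) (hG : IsReflectionGroup G) (hx₀ : x₀ ∉ mirrors G)
    {x y : V} (hx : x ∈ closedChamber G x₀) (hy : y ∈ closedChamber G x₀) :
    maxFilter G x y = inner ℝ x y := by
  refine IsGreatest.csSup_eq ⟨⟨x, mem_orbit_self x, y, mem_orbit_self y, rfl⟩, ?_⟩
  rintro _ ⟨p, hp, q, hq, rfl⟩
  exact inner_orbit_le hfin hG hx₀ hx hy hp hq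

theorem norm_of_mem_orbit {x p : V} (hp : p ∈ orbit G x) : ‖p‖ = ‖x‖ := by
  obtain ⟨g, -, rfl⟩ := hp
  exact g.norm_map x

/-- Norms are constant on orbits, so minimizing the distance amounts to maximizing the inner
product. -/
theorem orbitDist_eq_norm (hfin : Finite G) (hG : IsReflectionGroup G) (hx₀ : x₀ ∉ mirrors G)
    {x y : V} (hx : x ∈ closedChamber G x₀) (hy : y ∈ closedChamber G x₀) :
    orbitDist G x y = ‖x - y‖ := by
  refine IsLeast.csInf_eq ⟨⟨x, mem_orbit_self x, y, mem_orbit_self y, rfl⟩, ?_⟩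
  rintro _ ⟨p, hp, q, hq, rfl⟩
  refine le_of_sq_le_sq ?_ (norm_nonneg _)
  rw [norm_sub_sq_real, norm_sub_sq_real, norm_of_mem_orbit hp, norm_of_mem_orbit hq]
  linarith [inner_orbit_le hfin hG hx₀ hx hy hp hq]

theorem norm_sq_maxFilterBank_sub {ι : Type*} [Fintype ι] (t : ι → V) (x y : V) :
    ‖maxFilterBank G t x - maxFilterBank G t y‖ ^ 2 =
      ∑ i, (maxFilter G (t i) x - maxFilter G (t i) y) ^ 2 := by
  rw [EuclideanSpace.norm_sq_eq]
  simp [maxFilterBank]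

theorem hasLipschitzBounds_iff_sq {ι : Type*} [Fintype ι] {t : ι → V} {c C : ℝ}
    (hd : ∀ x y : V, 0 ≤ orbitDist G x y) :
    HasLipschitzBounds G t c C ↔ 0 < c ∧ 0 ≤ C ∧ ∀ x y : V,
      c ^ 2 * orbitDist G x y ^ 2 ≤ ∑ i, (maxFilter G (t i) x - maxFilter G (t i) y) ^ 2 ∧
      ∑ i, (maxFilter G (t i) x - maxFilter G (t i) y) ^ 2 ≤ C ^ 2 * orbitDist G x y ^ 2 := by
  unfold HasLipschitzBounds
  refine and_congr_right fun hc => and_congr_right fun hC => forall_congr' fun x =>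
    forall_congr' fun y => ?_
  rw [← norm_sq_maxFilterBank_sub, ← mul_pow, ← mul_pow,
    sq_le_sq₀ (mul_nonneg hc.le (hd x y)) (norm_nonneg _),
    sq_le_sq₀ (norm_nonneg _) (mul_nonneg hC (hd x y))]

theorem orbitDist_nonneg (x y : V) : 0 ≤ orbitDist G x y := by
  refine Real.sInf_nonneg ?_
  rintro _ ⟨p, -, q, -, rfl⟩
  exact norm_nonneg _

theorem hasLipschitzBounds_comp_equiv {ι κ : Type*} [Fintype ι] [Fintype κ] (e : κ ≃ ι)
    {t : ι → V} {c C : ℝ} (h : HasLipschitzBounds G t c C) :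
    HasLipschitzBounds G (t ∘ e) c C := by
  rw [hasLipschitzBounds_iff_sq orbitDist_nonneg] at h ⊢
  refine ⟨h.1, h.2.1, fun x y => ?_⟩
  have := h.2.2 x y
  rw [← Equiv.sum_comp e] at this
  exact this

theorem kappa_le_of_hasLipschitzBounds {ι : Type*} [Fintype ι] {t : ι → V} {c C : ℝ}
    (h : HasLipschitzBounds G t c C) : kappa G ≤ ENNReal.ofReal (C / c) :=
  sInf_le ⟨Fintype.card ι, t ∘ (Fintype.equivFin ι).symm, c, C,
    hasLipschitzBounds_comp_equiv _ h, rfl⟩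

theorem le_kappa {r : ℝ} (h : ∀ (n : ℕ) (t : Fin n → V) (c C : ℝ), HasLipschitzBounds G t c C →
    r ≤ C / c) : ENNReal.ofReal r ≤ kappa G := by
  refine le_sInf ?_
  rintro _ ⟨n, t, c, C, ht, rfl⟩
  exact ENNReal.ofReal_le_ofReal (h n t c C ht)

/-- A max filter depends on its template only through the orbit, so each template can be replaced by
a representative in the chamber. -/
theorem exists_templates_mem (hfin : Finite G) (x₀ : V) {ι : Type*} [Fintype ι] (t : ι → V) :
    ∃ t' : ι → V, (∀ i, t' i ∈ closedChamber G x₀) ∧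
      ∀ c C, HasLipschitzBounds G t c C ↔ HasLipschitzBounds G t' c C := by
  choose g hg hm using fun i => exists_map_mem_closedChamber hfin x₀ (t i)
  refine ⟨fun i => g i (t i), hm, fun c C => ?_⟩
  rw [hasLipschitzBounds_iff_sq orbitDist_nonneg, hasLipschitzBounds_iff_sq orbitDist_nonneg]
  simp only [maxFilter_map_left (hg _)]

/-- For templates in a closed chamber, Lipschitz bounds are frame bounds. -/
theorem hasLipschitzBounds_iff (hfin : Finite G) (hG : IsReflectionGroup G)
    (hx₀ : x₀ ∉ mirrors G) {ι : Type*} [Fintype ι] {t : ι → V}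
    (ht : ∀ i, t i ∈ closedChamber G x₀) {c C : ℝ} :
    HasLipschitzBounds G t c C ↔ 0 < c ∧ 0 ≤ C ∧ ∀ v : V,
      c ^ 2 * ‖v‖ ^ 2 ≤ ∑ i, inner ℝ (t i) v ^ 2 ∧ ∑ i, inner ℝ (t i) v ^ 2 ≤ C ^ 2 * ‖v‖ ^ 2 := by
  rw [hasLipschitzBounds_iff_sq orbitDist_nonneg]
  refine and_congr_right fun hc => and_congr_right fun hC => ⟨fun h v => ?_, fun h x y => ?_⟩
  -- The open chamber is a neighbourhood of `x₀`, so every vector is, up to scaling, a difference of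
  -- two chamber points.
  · obtain ⟨s, hs, hsv⟩ : ∃ s : ℝ, 0 < s ∧ x₀ + s • v ∈ openChamber G x₀ := by
      have hcont : Continuous fun s : ℝ => x₀ + s • v := by fun_prop
      have h0 : ∀ᶠ s in nhds (0 : ℝ), x₀ + s • v ∈ openChamber G x₀ := by
        refine hcont.continuousAt.eventually_mem ((isOpen_openChamber hfin).mem_nhds ?_)
        simpa using mem_openChamber_self
      have h1 := (h0.filter_mono (nhdsWithin_le_nhds (s := Set.Ioi 0))).and
        (self_mem_nhdsWithin)
      obtain ⟨s, hs⟩ := h1.exists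
      exact ⟨s, hs.2, hs.1⟩
    have hK := openChamber_subset_closedChamber hsv
    have hK₀ : x₀ ∈ closedChamber G x₀ := openChamber_subset_closedChamber mem_openChamber_self
    have h1 := h (x₀ + s • v) x₀
    rw [orbitDist_eq_norm hfin hG hx₀ hK hK₀] at h1
    have e : ∀ i, maxFilter G (t i) (x₀ + s • v) - maxFilter G (t i) x₀
        = s * inner ℝ (t i) v := by
      intro i
      rw [maxFilter_eq_inner hfin hG hx₀ (ht i) hK, maxFilter_eq_inner hfin hG hx₀ (ht i) hK₀,
        inner_add_right, inner_smul_right]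
      ring
    simp only [e, mul_pow, ← Finset.mul_sum, add_sub_cancel_left, norm_smul,
      Real.norm_eq_abs, sq_abs] at h1
    have hs2 : 0 < s ^ 2 := by positivity
    constructor
    · refine le_of_mul_le_mul_left ?_ hs2
      linarith [h1.1]
    · refine le_of_mul_le_mul_left ?_ hs2
      linarith [h1.2]
  · obtain ⟨g, hg, hx⟩ := exists_map_mem_closedChamber hfin x₀ x
    obtain ⟨g', hg', hy⟩ := exists_map_mem_closedChamber hfin x₀ y
    rw [← orbitDist_map_left hg, ← orbitDist_map_right hg',
      orbitDist_eq_norm hfin hG hx₀ hx hy]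
    have e : ∀ i, maxFilter G (t i) x - maxFilter G (t i) y = inner ℝ (t i) (g x - g' y) := by
      intro i
      rw [← maxFilter_map_right hg, ← maxFilter_map_right hg' (t i) y,
        maxFilter_eq_inner hfin hG hx₀ (ht i) hx, maxFilter_eq_inner hfin hG hx₀ (ht i) hy,
        inner_sub_right]
    simp only [e]
    exact h _

/-- A positive lower frame bound makes the map `v ↦ (⟨t' i, v⟩)` injective. -/
theorem finrank_le_card [FiniteDimensional ℝ V] (hfin : Finite G) (hG : IsReflectionGroup G)
    {ι : Type*} [Fintype ι] {t : ι → V} {c C : ℝ} (h : HasLipschitzBounds G t c C) :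
    Module.finrank ℝ V ≤ Fintype.card ι := by
  obtain ⟨x₀, hx₀⟩ := exists_notMem_mirrors hfin
  obtain ⟨t', ht', hiff⟩ := exists_templates_mem hfin x₀ t
  obtain ⟨hc, -, hb⟩ := (hasLipschitzBounds_iff hfin hG hx₀ ht').1 ((hiff c C).1 h)
  let L : V →ₗ[ℝ] (ι → ℝ) := LinearMap.pi fun i => innerₛₗ ℝ (t' i)
  have hinj : Function.Injective L := by
    rw [injective_iff_map_eq_zero]
    intro v hv
    have h1 : ∀ i, inner ℝ (t' i) v = (0 : ℝ) := fun i => congrFun hv i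
    have h2 := (hb v).1
    simp only [h1] at h2
    norm_num at h2
    by_contra hne
    have : 0 < c ^ 2 * ‖v‖ ^ 2 := by
      have := norm_pos_iff.2 hne
      positivity
    linarith
  have := LinearMap.finrank_le_finrank_of_injective hinj
  rwa [Module.finrank_fintype_fun_eq_card] at this

theorem one_le_div_of_hasLipschitzBounds [Nontrivial V] (hfin : Finite G)
    (hG : IsReflectionGroup G) {ι : Type*} [Fintype ι] {t : ι → V} {c C : ℝ}
    (h : HasLipschitzBounds G t c C) : 1 ≤ C / c := by
  obtain ⟨x₀, hx₀⟩ := exists_notMem_mirrors hfin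
  obtain ⟨t', ht', hiff⟩ := exists_templates_mem hfin x₀ t
  obtain ⟨hc, hC, hb⟩ := (hasLipschitzBounds_iff hfin hG hx₀ ht').1 ((hiff c C).1 h)
  obtain ⟨v, hv⟩ := exists_ne (0 : V)
  rw [one_le_div hc]
  have h1 := (hb v).1.trans (hb v).2
  have h2 : 0 < ‖v‖ ^ 2 := by have := norm_pos_iff.2 hv; positivity
  exact le_of_sq_le_sq (le_of_mul_le_mul_right h1 h2) hC

theorem isMinimalOptimal_of_kappa_eq [FiniteDimensional ℝ V] (hfin : Finite G)
    (hG : IsReflectionGroup G) {ι : Type*} [Fintype ι] {t : ι → V} {c C : ℝ}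
    (h : HasLipschitzBounds G t c C) (hk : kappa G = ENNReal.ofReal (C / c))
    (hcard : Fintype.card ι = Module.finrank ℝ V) : IsMinimalOptimal G t := by
  refine ⟨⟨c, C, h, hk.symm⟩, ?_⟩
  rintro n s ⟨c', C', hs, -⟩
  rw [hcard]
  simpa using finrank_le_card hfin hG hs

/-- For `t` in the chamber all `⟨t, α i⟩` are nonnegative, so the triangle inequality gives `|⟨t, ∑
w i • α i⟩| ≤ ⟨t, ∑ |w i| • α i⟩`; the frame bounds do the rest. This is the source of the lower
bound for `kappa` in the essential case. -/
theorem norm_sum_le_of_hasLipschitzBounds (hfin : Finite G) (hG : IsReflectionGroup G)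
    (hx₀ : x₀ ∉ mirrors G) {κ : Type*} [Fintype κ] {α : κ → V}
    (hα : ∀ i, ∀ x ∈ closedChamber G x₀, 0 ≤ (inner ℝ (α i) x : ℝ))
    {ι : Type*} [Fintype ι] {t : ι → V} {c C : ℝ}
    (h : HasLipschitzBounds G t c C) (w : κ → ℝ) :
    c * ‖∑ i, w i • α i‖ ≤ C * ‖∑ i, |w i| • α i‖ := by
  obtain ⟨t', ht', hiff⟩ := exists_templates_mem hfin x₀ t
  obtain ⟨hc, hC, hb⟩ := (hasLipschitzBounds_iff hfin hG hx₀ ht').1 ((hiff c C).1 h)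
  refine le_of_sq_le_sq ?_ (by positivity)
  rw [mul_pow, mul_pow]
  refine (hb _).1.trans (le_trans ?_ (hb _).2)
  refine Finset.sum_le_sum fun j _ => ?_
  refine sq_le_sq.2 ?_
  simp only [inner_sum, inner_smul_right]
  refine (Finset.abs_sum_le_sum_abs _ _).trans ((Finset.sum_le_sum fun i _ => ?_).trans
    (le_abs_self _))
  have := hα i _ (ht' j)
  rw [real_inner_comm] at this
  rw [abs_mul, abs_of_nonneg this]

end FilterBanks

/-! ### The trivial group -/

section TrivialGroup

variable {V : Type*} [NormedAddCommGroup V] [InnerProductSpace ℝ V]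

theorem isReflectionGroup_bot : IsReflectionGroup (⊥ : Subgroup (O V)) :=
  ⟨∅, by simp, by simp⟩

theorem bot_orthonormalBasis {ι : Type*} [Fintype ι] (b : OrthonormalBasis ι ℝ V) :
    HasLipschitzBounds (⊥ : Subgroup (O V)) b 1 1 := by
  have hfin : Finite (⊥ : Subgroup (O V)) := inferInstance
  obtain ⟨x₀, hx₀⟩ := exists_notMem_mirrors hfin
  -- Without roots the chamber is the whole space, so the frame bounds are Parseval's identity.
  have hK : ∀ x : V, x ∈ closedChamber (⊥ : Subgroup (O V)) x₀ := by
    intro x u hu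
    exfalso
    exact refl_ne_one (ne_zero_of_norm_eq_one hu.1.1) (Subgroup.mem_bot.1 hu.1.2)
  refine (hasLipschitzBounds_iff hfin isReflectionGroup_bot hx₀ fun i => hK _).2
    ⟨one_pos, zero_le_one, fun v => ?_⟩
  have := b.sum_sq_norm_inner_right v
  simp only [Real.norm_eq_abs, sq_abs] at this
  rw [this]
  simp

theorem kappa_bot [FiniteDimensional ℝ V] [Nontrivial V] : kappa (⊥ : Subgroup (O V)) = 1 := by
  apply le_antisymm
  · have := kappa_le_of_hasLipschitzBounds (bot_orthonormalBasis (stdOrthonormalBasis ℝ V))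
    simpa using this
  · have := le_kappa (G := (⊥ : Subgroup (O V))) (r := 1) fun n t c C h =>
      one_le_div_of_hasLipschitzBounds inferInstance isReflectionGroup_bot h
    simpa using this

end TrivialGroup

/-! ### Extreme singular values and the adjoint -/

section SingularValues

open Module

variable {E : Type*} [NormedAddCommGroup E] [InnerProductSpace ℝ E] [FiniteDimensional ℝ E]

/-- The extreme singular values of an invertible operator bound the norms of its adjoint, and both
bounds are attained. -/
theorem adjoint_bounds_of_injective (T : E →ₗ[ℝ] E) (hT : Function.Injective T) {d : ℕ}
    (hd : 1 ≤ d) (hn : finrank ℝ E = d) :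
    0 < T.singularValues (d - 1) ∧
    (∀ w, T.singularValues (d - 1) * ‖w‖ ≤ ‖T.adjoint w‖) ∧
    (∀ w, ‖T.adjoint w‖ ≤ T.singularValues 0 * ‖w‖) ∧
    (∃ w, w ≠ 0 ∧ ‖T.adjoint w‖ = T.singularValues 0 * ‖w‖) ∧
    (∃ w, w ≠ 0 ∧ ‖T.adjoint w‖ = T.singularValues (d - 1) * ‖w‖) := by
  have hS := T.isSymmetric_adjoint_comp_self
  set b := hS.eigenvectorBasis hn with hb
  have hpos : ∀ i < d, 0 < T.singularValues i := fun i hi =>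
    T.injective_iff_forall_lt_finrank_singularValues_pos.1 hT i (by omega)
  have heig : ∀ i : Fin d, T.adjoint (T (b i)) = (T.singularValues i) ^ 2 • b i := by
    intro i
    rw [T.sq_singularValues_fin hn i]
    exact hS.apply_eigenvectorBasis hn i
  -- The witness is `T (b i)`, where `b` is an orthonormal eigenbasis of `T* T`.
  have hatt : ∀ i : Fin d, ∃ w, w ≠ 0 ∧ ‖T.adjoint w‖ = T.singularValues i * ‖w‖ := by
    intro i
    have h1 : ‖T (b i)‖ = T.singularValues i := by
      have h2 : ‖T (b i)‖ ^ 2 = T.singularValues i ^ 2 := by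
        rw [← real_inner_self_eq_norm_sq, ← LinearMap.adjoint_inner_left, heig,
          inner_smul_left, real_inner_self_eq_norm_sq, b.norm_eq_one]
        simp
      exact (sq_eq_sq₀ (norm_nonneg _) (hpos i i.2).le).1 h2
    refine ⟨T (b i), fun h0 => ?_, ?_⟩
    · rw [h0, norm_zero] at h1
      exact (hpos i i.2).ne h1
    · rw [heig, h1, norm_smul, b.norm_eq_one, mul_one, Real.norm_of_nonneg (by positivity), sq]
  have hexp : ∀ x, ‖T x‖ ^ 2 = ∑ i : Fin d, T.singularValues i ^ 2 * inner ℝ (b i) x ^ 2 := by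
    intro x
    rw [← real_inner_self_eq_norm_sq, ← LinearMap.adjoint_inner_left, ← b.sum_inner_mul_inner]
    refine Finset.sum_congr rfl fun i _ => ?_
    rw [LinearMap.adjoint_inner_left, ← LinearMap.adjoint_inner_right, heig, inner_smul_right,
      real_inner_comm]
    ring
  have hnorm : ∀ x, ‖x‖ ^ 2 = ∑ i, inner ℝ (b i) x ^ 2 := by
    intro x
    rw [← b.sum_sq_norm_inner_right]
    simp
  have hup : ∀ x, ‖T x‖ ≤ T.singularValues 0 * ‖x‖ := by
    intro x
    refine le_of_sq_le_sq ?_ (mul_nonneg (T.singularValues_nonneg 0) (norm_nonneg _))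
    rw [mul_pow, hexp, hnorm, Finset.mul_sum]
    refine Finset.sum_le_sum fun i _ => mul_le_mul_of_nonneg_right ?_ (sq_nonneg _)
    exact pow_le_pow_left₀ (T.singularValues_nonneg _) (T.singularValues_antitone (Nat.zero_le _)) 2
  have hlow : ∀ x, T.singularValues (d - 1) * ‖x‖ ≤ ‖T x‖ := by
    intro x
    refine le_of_sq_le_sq ?_ (norm_nonneg _)
    rw [mul_pow, hexp, hnorm, Finset.mul_sum]
    refine Finset.sum_le_sum fun i _ => mul_le_mul_of_nonneg_right ?_ (sq_nonneg _)
    exact pow_le_pow_left₀ (T.singularValues_nonneg _)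
      (T.singularValues_antitone (by omega)) 2
  have hsurj : Function.Surjective T := LinearMap.injective_iff_surjective.1 hT
  refine ⟨hpos _ (by omega), fun w => ?_, fun w => ?_, hatt ⟨0, by omega⟩,
    hatt ⟨d - 1, by omega⟩⟩
  -- The lower bound for the adjoint follows from that for `T` through `‖T x‖² = ⟨T* T x, x⟩`; the
  -- upper one below is dual.
  · obtain ⟨x, rfl⟩ := hsurj w
    rcases eq_or_ne x 0 with rfl | hx
    · simp
    have h1 : ‖T x‖ ^ 2 ≤ ‖T.adjoint (T x)‖ * ‖x‖ := by
      rw [← real_inner_self_eq_norm_sq, ← LinearMap.adjoint_inner_left]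
      exact real_inner_le_norm _ _
    refine le_of_mul_le_mul_right ?_ (norm_pos_iff.2 hx)
    nlinarith [mul_le_mul_of_nonneg_left (hlow x) (norm_nonneg (T x))]
  · rcases eq_or_ne (T.adjoint w) 0 with h0 | h0
    · rw [h0, norm_zero]; exact mul_nonneg (T.singularValues_nonneg 0) (norm_nonneg _)
    have h1 : ‖T.adjoint w‖ ^ 2 ≤ ‖w‖ * ‖T (T.adjoint w)‖ := by
      rw [← real_inner_self_eq_norm_sq, LinearMap.adjoint_inner_left]
      exact real_inner_le_norm _ _
    refine le_of_mul_le_mul_right ?_ (norm_pos_iff.2 h0)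
    nlinarith [mul_le_mul_of_nonneg_left (hup (T.adjoint w)) (norm_nonneg w)]

end SingularValues

/-! ### Bipartite Coxeter graphs and sign changes -/

section Obtuse

variable {V : Type*} [NormedAddCommGroup V] [InnerProductSpace ℝ V]
  {ι : Type*} [Fintype ι] {α : ι → V}

/-- The Coxeter graph of a linearly independent family of unit vectors with pairwise inner products
`0` or at most `-1/2` is bipartite. -/
theorem exists_two_coloring (hn : ∀ i, ‖α i‖ = 1)
    (hob : ∀ i j, i ≠ j → inner ℝ (α i) (α j) = (0 : ℝ) ∨ inner ℝ (α i) (α j) ≤ (-(1 / 2) : ℝ))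
    (hli : LinearIndependent ℝ α) :
    ∃ ε : ι → ℝ, (∀ i, ε i = 1 ∨ ε i = -1) ∧
      ∀ i j, i ≠ j → inner ℝ (α i) (α j) ≠ (0 : ℝ) → ε i = -ε j := by
  classical
  suffices h : ∀ s : Finset ι, ∃ ε : ι → ℝ, (∀ i, ε i = 1 ∨ ε i = -1) ∧
      ∀ i ∈ s, ∀ j ∈ s, i ≠ j → inner ℝ (α i) (α j) ≠ (0 : ℝ) → ε i = -ε j by
    obtain ⟨ε, h1, h2⟩ := h Finset.univ
    exact ⟨ε, h1, fun i j => h2 i (Finset.mem_univ _) j (Finset.mem_univ _)⟩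
  intro s
  induction s using Finset.strongInduction with
  | _ s ih =>
    rcases s.eq_empty_or_nonempty with rfl | hne
    · exact ⟨fun _ => 1, fun _ => Or.inl rfl, by simp⟩
    -- Some vertex has at most one neighbour in `s`. Otherwise each row of the Gram matrix over `s`
    -- sums to at most `1 - 1/2 - 1/2 = 0`, so the vectors of `s` add up to zero, against
    -- independence. Such a vertex can be coloured last.
    obtain ⟨a, ha, hdeg⟩ : ∃ a ∈ s, ∀ b ∈ s, ∀ b' ∈ s, b ≠ a → b' ≠ a →
        inner ℝ (α a) (α b) ≠ (0 : ℝ) → inner ℝ (α a) (α b') ≠ (0 : ℝ) → b = b' := by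
      by_contra! hcon
      have h1 : ∀ a ∈ s, ∑ b ∈ s, inner ℝ (α a) (α b) ≤ (0 : ℝ) := by
        intro a ha
        obtain ⟨b, hb, b', hb', hba, hb'a, h0, h0', hbb'⟩ := hcon a ha
        have e1 := (hob a b hba.symm).resolve_left h0
        have e2 := (hob a b' hb'a.symm).resolve_left h0'
        rw [← Finset.add_sum_erase _ _ ha,
          ← Finset.add_sum_erase _ _ (Finset.mem_erase.2 ⟨hba, hb⟩),
          ← Finset.add_sum_erase _ _
            (Finset.mem_erase.2 ⟨hbb'.symm, Finset.mem_erase.2 ⟨hb'a, hb'⟩⟩),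
          real_inner_self_eq_norm_sq, hn]
        have e3 : ∑ x ∈ ((s.erase a).erase b).erase b', inner ℝ (α a) (α x) ≤ (0 : ℝ) := by
          refine Finset.sum_nonpos fun x hx => ?_
          have hxa : x ≠ a := by
            rintro rfl; simp at hx
          rcases hob a x hxa.symm with h | h
          · exact h.le
          · linarith
        linarith
      have h2 : ‖∑ a ∈ s, α a‖ ^ 2 ≤ 0 := by
        rw [← real_inner_self_eq_norm_sq, sum_inner]
        refine Finset.sum_nonpos fun a ha => ?_
        rw [inner_sum]; exact h1 a ha
      have h3 : ∑ a ∈ s, (1 : ℝ) • α a = 0 := by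
        simp only [one_smul]
        exact norm_eq_zero.1 (pow_eq_zero_iff two_ne_zero |>.1 (le_antisymm h2 (sq_nonneg _)))
      obtain ⟨a, ha⟩ := hne
      exact one_ne_zero (linearIndependent_iff'.1 hli s _ h3 a ha)
    obtain ⟨ε, hε, hadj⟩ := ih (s.erase a) (Finset.erase_ssubset ha)
    obtain ⟨v, hv, hvb⟩ : ∃ v : ℝ, (v = 1 ∨ v = -1) ∧ ∀ b ∈ s, b ≠ a →
        inner ℝ (α a) (α b) ≠ (0 : ℝ) → v = -ε b := by
      by_cases hex : ∃ b ∈ s, b ≠ a ∧ inner ℝ (α a) (α b) ≠ (0 : ℝ)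
      · obtain ⟨b, hb, hba, h0⟩ := hex
        refine ⟨-ε b, ?_, fun b' hb' hb'a h0' => ?_⟩
        · rcases hε b with h | h
          · right; rw [h]
          · left; rw [h, neg_neg]
        · rw [hdeg b hb b' hb' hba hb'a h0 h0']
      · push Not at hex
        exact ⟨1, Or.inl rfl, fun b hb hba h0 => absurd (hex b hb hba) h0⟩
    refine ⟨Function.update ε a v, fun i => ?_, fun i hi j hj hij h0 => ?_⟩
    · by_cases hia : i = a
      · subst hia; simpa using hv
      · rw [Function.update_of_ne hia]; exact hε i
    · by_cases hia : i = a
      · subst hia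
        rw [Function.update_self, Function.update_of_ne hij.symm]
        exact hvb j hj hij.symm h0
      · by_cases hja : j = a
        · subst hja
          rw [Function.update_self, Function.update_of_ne hij]
          rw [hvb i hi hij (by rwa [real_inner_comm]), neg_neg]
        · rw [Function.update_of_ne hia, Function.update_of_ne hja]
          exact hadj i (Finset.mem_erase.2 ⟨hia, hi⟩) j (Finset.mem_erase.2 ⟨hja, hj⟩) hij h0

theorem norm_sq_sum_smul (w : ι → ℝ) :
    ‖∑ i, w i • α i‖ ^ 2 = ∑ i, ∑ j, w i * w j * inner ℝ (α i) (α j) := by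
  rw [← real_inner_self_eq_norm_sq, sum_inner]
  refine Finset.sum_congr rfl fun i _ => ?_
  rw [inner_sum]
  refine Finset.sum_congr rfl fun j _ => ?_
  rw [inner_smul_left, inner_smul_right]
  simp; ring

/-- The colouring flips the sign of every Gram entry off the diagonal and keeps the diagonal, which
consists of ones; the two quadratic forms therefore add up to `2 ∑ w i ^ 2`. -/
theorem norm_sq_sum_coloring (hn : ∀ i, ‖α i‖ = 1) {ε : ι → ℝ}
    (hε : ∀ i, ε i = 1 ∨ ε i = -1)
    (hadj : ∀ i j, i ≠ j → inner ℝ (α i) (α j) ≠ (0 : ℝ) → ε i = -ε j) (w : ι → ℝ) :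
    ‖∑ i, (ε i * w i) • α i‖ ^ 2 = 2 * ∑ i, w i ^ 2 - ‖∑ i, w i • α i‖ ^ 2 := by
  classical
  rw [norm_sq_sum_smul, norm_sq_sum_smul, eq_sub_iff_add_eq, ← Finset.sum_add_distrib,
    Finset.mul_sum]
  refine Finset.sum_congr rfl fun i _ => ?_
  rw [← Finset.sum_add_distrib, Finset.sum_eq_single_of_mem i (Finset.mem_univ i)]
  · rw [real_inner_self_eq_norm_sq, hn]
    rcases hε i with h | h <;> rw [h] <;> ring
  · intro j _ hj
    by_cases h0 : inner ℝ (α i) (α j) = (0 : ℝ)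
    · rw [h0]; ring
    · rw [hadj i j hj.symm h0]
      rcases hε j with h | h <;> rw [h] <;> ring

/-- Only the terms off the diagonal change: `w i * w j` becomes `|w i| * |w j|`, and its coefficient
is nonpositive. -/
theorem norm_sq_sum_abs_le (hob : ∀ i j, i ≠ j → inner ℝ (α i) (α j) ≤ (0 : ℝ)) (w : ι → ℝ) :
    ‖∑ i, |w i| • α i‖ ^ 2 ≤ ‖∑ i, w i • α i‖ ^ 2 := by
  rw [norm_sq_sum_smul, norm_sq_sum_smul]
  refine Finset.sum_le_sum fun i _ => Finset.sum_le_sum fun j _ => ?_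
  by_cases hij : i = j
  · subst hij; rw [abs_mul_abs_self]
  · rw [← abs_mul]
    exact mul_le_mul_of_nonpos_right (le_abs_self _) (hob i j hij)

end Obtuse

/-! ### Geometry and existence of fundamental systems -/

section FundamentalSystems

variable {V : Type*} [NormedAddCommGroup V] [InnerProductSpace ℝ V] [FiniteDimensional ℝ V]
  {G : Subgroup (O V)}

theorem IsFundamentalSystem.properties (hfin : Finite G)
    {ι : Type*} [Fintype ι] {α : ι → V} (hα : IsFundamentalSystem G α) :
    (∀ i, ‖α i‖ = 1) ∧
    (∀ i j, i ≠ j → inner ℝ (α i) (α j) = (0 : ℝ) ∨ inner ℝ (α i) (α j) ≤ (-(1 / 2) : ℝ)) ∧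
    LinearIndependent ℝ α ∧
    (∃ x₀ ∉ mirrors G, ∀ x, x ∈ closedChamber G x₀ ↔ ∀ i, 0 ≤ (inner ℝ (α i) x : ℝ)) := by
  obtain ⟨x₀, hx₀, Δ, h, e, he⟩ := hα.exists_isSimpleSystem hfin
  refine ⟨fun i => ?_, fun i j hij => ?_, ?_, x₀, hx₀, fun x => ?_⟩
  · rw [he]; exact (h.mem_posRoots _ (e i).2).1.1
  · rw [he, he]
    exact h.inner_eq_zero_or_le hx₀ (e i).2 (e j).2
      fun h1 => hij (e.injective (Subtype.ext h1))
  · have h1 : LinearIndependent ℝ (fun a : Δ => (a : V)) := h.linearIndepOn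
    have h2 := h1.comp e e.injective
    convert h2 using 1
    funext i
    exact he i
  · rw [h.mem_closedChamber_iff]
    constructor
    · intro hx i; rw [he]; exact hx _ (e i).2
    · intro hx a ha
      have := hx (e.symm ⟨a, ha⟩)
      rw [he] at this
      simpa using this

theorem exists_isFundamentalSystem (hfin : Finite G) (hG : IsReflectionGroup G)
    (hess : IsEssential G) {d : ℕ} (hd : Module.finrank ℝ V = d) :
    ∃ α : Fin d → V, IsFundamentalSystem G α := by
  obtain ⟨x₀, hx₀⟩ := exists_notMem_mirrors hfin
  obtain ⟨Δ, h⟩ := exists_isSimpleSystem hfin hx₀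
  have hcard : Δ.card = d := by
    have h1 : LinearIndependent ℝ (fun a : Δ => (a : V)) := h.linearIndepOn
    have h2 := finrank_span_eq_card h1
    rw [Fintype.card_coe] at h2
    rw [← h2, ← hd]
    have h3 : Set.range (fun a : Δ => (a : V)) = (Δ : Set V) := Subtype.range_coe
    rw [h3, span_eq_top_of_isEssential h hx₀ hG hess, finrank_top]
  exact ⟨_, h.isFundamentalSystem hfin hx₀ (Δ.equivFinOfCardEq hcard).symm⟩

end FundamentalSystems

/-! ### The condition number from the matrix of simple roots -/

section Essential

variable {d : ℕ} {G : Subgroup (O (Euc d))}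

/-- `t` has the Lipschitz bounds `1/M` and `1/m`, where `m ^ 2 + M ^ 2 = 2`, and they are
optimal. -/
def HasBalancedBounds {V : Type*} [NormedAddCommGroup V] [InnerProductSpace ℝ V]
    (G : Subgroup (O V)) {ι : Type*} [Fintype ι] (t : ι → V) (m M : ℝ) : Prop :=
  0 < m ∧ m ≤ M ∧ m ^ 2 + M ^ 2 = 2 ∧ HasLipschitzBounds G t M⁻¹ m⁻¹ ∧
    kappa G = ENNReal.ofReal (M / m)

theorem toEuclideanLin_apply_eq_inner (A : Matrix (Fin d) (Fin d) ℝ) (x : Euc d) (i : Fin d) :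
    Matrix.toEuclideanLin A x i = inner ℝ (row A i) x := by
  simp [PiLp.inner_apply, row, Matrix.toLpLin_apply, Matrix.mulVec, dotProduct, mul_comm]

theorem adjoint_toEuclideanLin_apply (A : Matrix (Fin d) (Fin d) ℝ) (w : Euc d) :
    (Matrix.toEuclideanLin A).adjoint w = ∑ i, w i • row A i := by
  refine ext_inner_right ℝ fun x => ?_
  rw [LinearMap.adjoint_inner_left, PiLp.inner_apply, sum_inner]
  refine Finset.sum_congr rfl fun i _ => ?_
  rw [toEuclideanLin_apply_eq_inner, inner_smul_left]
  simp [mul_comm]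

theorem isUnit_det_of_linearIndependent_row {A : Matrix (Fin d) (Fin d) ℝ}
    (h : LinearIndependent ℝ (row A)) : IsUnit A.det := by
  rw [← Matrix.isUnit_iff_isUnit_det, ← Matrix.linearIndependent_rows_iff_isUnit]
  exact h.map' (WithLp.linearEquiv 2 ℝ (Fin d → ℝ)).toLinearMap (LinearEquiv.ker _)

theorem inner_row_col_inv {A : Matrix (Fin d) (Fin d) ℝ} (h : IsUnit A.det) (i j : Fin d) :
    inner ℝ (row A i) (col A⁻¹ j) = if i = j then (1 : ℝ) else 0 := by
  have h1 := congrFun (congrFun (Matrix.mul_nonsing_inv A h) i) j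
  rw [Matrix.mul_apply, Matrix.one_apply] at h1
  rw [← h1]
  simp [PiLp.inner_apply, row, col, mul_comm]

/-- The adjoint of `A` sends `w` to `∑ w i • row A i`, so the singular values of `A` measure such
combinations. The dual basis gives the upper bound for `kappa`; a vector that attains the largest
singular value, together with the 2-colouring, gives the lower one. -/
theorem hasBalancedBounds_of_isFundamentalSystem (hd : 1 ≤ d) (hfin : Finite G)
    (hG : IsReflectionGroup G) {A : Matrix (Fin d) (Fin d) ℝ}
    (hA : IsFundamentalSystem G (row A)) :
    IsUnit A.det ∧ HasBalancedBounds G (col A⁻¹) (sigmaMin A) (sigmaMax A) := by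
  obtain ⟨hn, hob, hli, x₀, hx₀, hK⟩ := hA.properties hfin
  have hdet := isUnit_det_of_linearIndependent_row hli
  refine ⟨hdet, ?_⟩
  set T := Matrix.toEuclideanLin A with hT
  have hTl : T.adjoint = Fintype.linearCombination ℝ (row A) ∘ₗ
      (WithLp.linearEquiv 2 ℝ (Fin d → ℝ)).toLinearMap := by
    ext1 w
    rw [hT, adjoint_toEuclideanLin_apply]
    rfl
  have hadjinj : Function.Injective T.adjoint := by
    rw [hTl]
    exact hli.fintypeLinearCombination_injective.comp (LinearEquiv.injective _)
  have hadjsurj : Function.Surjective T.adjoint := LinearMap.injective_iff_surjective.1 hadjinj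
  have hinj : Function.Injective T := by
    rw [injective_iff_map_eq_zero]
    intro x hx
    refine ext_inner_right ℝ fun y => ?_
    obtain ⟨w, rfl⟩ := hadjsurj y
    rw [LinearMap.adjoint_inner_right, hx, inner_zero_left, inner_zero_left]
  obtain ⟨hm, hlow, hup, ⟨w, hw0, hw⟩, ⟨z, hz0, hz⟩⟩ :=
    adjoint_bounds_of_injective T hinj hd (finrank_euclideanSpace_fin)
  change 0 < sigmaMin A at hm
  change ∀ w, sigmaMin A * ‖w‖ ≤ ‖T.adjoint w‖ at hlow
  change ∀ w, ‖T.adjoint w‖ ≤ sigmaMax A * ‖w‖ at hup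
  change ‖T.adjoint w‖ = sigmaMax A * ‖w‖ at hw
  change ‖T.adjoint z‖ = sigmaMin A * ‖z‖ at hz
  set m := sigmaMin A
  set M := sigmaMax A
  have hmM : m ≤ M := by
    have := norm_pos_iff.2 hw0
    exact le_of_mul_le_mul_right ((hlow w).trans (hup w)) this
  have hM : 0 < M := hm.trans_le hmM
  obtain ⟨ε, hε, hadj⟩ := exists_two_coloring hn hob hli
  have hcol : ∀ w : Euc d, ‖T.adjoint (WithLp.toLp 2 fun i => ε i * w i)‖ ^ 2 =
      2 * ‖w‖ ^ 2 - ‖T.adjoint w‖ ^ 2 := by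
    intro w
    rw [hT, adjoint_toEuclideanLin_apply, adjoint_toEuclideanLin_apply,
      EuclideanSpace.real_norm_sq_eq w]
    exact norm_sq_sum_coloring hn hε hadj w
  have hcn : ∀ w : Euc d, ‖(WithLp.toLp 2 fun i => ε i * w i : Euc d)‖ ^ 2 = ‖w‖ ^ 2 := by
    intro w
    rw [EuclideanSpace.norm_sq_eq, EuclideanSpace.norm_sq_eq]
    refine Finset.sum_congr rfl fun i _ => ?_
    rcases hε i with h | h <;> simp [h]
  have hwp : 0 < ‖w‖ ^ 2 := by have := norm_pos_iff.2 hw0; positivity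
  have hzp : 0 < ‖z‖ ^ 2 := by have := norm_pos_iff.2 hz0; positivity
  -- Recolouring a vector that attains `M` gives the value `2 - M²`, to be compared with the minimum
  -- `m²`; recolouring one that attains `m` gives `2 - m²`, to be compared with `M²`.
  have hsum : m ^ 2 + M ^ 2 = 2 := by
    apply le_antisymm
    · have h1 := pow_le_pow_left₀ (by positivity) (hlow (WithLp.toLp 2 fun i => ε i * w i)) 2
      rw [mul_pow, hcn, hcol, hw, mul_pow] at h1
      refine le_of_mul_le_mul_right ?_ hwp
      linarith
    · have h1 := pow_le_pow_left₀ (by positivity) (hup (WithLp.toLp 2 fun i => ε i * z i)) 2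
      rw [mul_pow, hcn, hcol, hz, mul_pow] at h1
      refine le_of_mul_le_mul_right ?_ hzp
      linarith
  have hbd : HasLipschitzBounds G (col A⁻¹) M⁻¹ m⁻¹ := by
    refine (hasLipschitzBounds_iff hfin hG hx₀ fun j => (hK _).2 fun i => ?_).2
      ⟨inv_pos.2 hM, (inv_pos.2 hm).le, fun v => ?_⟩
    · rw [inner_row_col_inv hdet]; split_ifs <;> norm_num
    · obtain ⟨y, rfl⟩ := hadjsurj v
      -- Duality: pairing with the columns of `A⁻¹` reads off the coordinates with respect to the
      -- rows of `A`.
      have h1 : ∀ j, inner ℝ (col A⁻¹ j) (T.adjoint y) = y j := by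
        intro j
        rw [hT, adjoint_toEuclideanLin_apply, inner_sum]
        simp only [inner_smul_right, real_inner_comm (row A _), inner_row_col_inv hdet]
        simp
      have h2 : ∑ j, inner ℝ (col A⁻¹ j) (T.adjoint y) ^ 2 = ‖y‖ ^ 2 := by
        rw [EuclideanSpace.norm_sq_eq]
        simp only [h1, Real.norm_eq_abs, sq_abs]
      rw [h2, ← mul_pow, ← mul_pow]
      constructor
      · refine pow_le_pow_left₀ (by positivity) ?_ 2
        rw [inv_mul_le_iff₀ hM]; exact hup y
      · refine pow_le_pow_left₀ (norm_nonneg _) ?_ 2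
        rw [le_inv_mul_iff₀ hm]; exact hlow y
  refine ⟨hm, hmM, hsum, hbd, le_antisymm ?_ ?_⟩
  · have := kappa_le_of_hasLipschitzBounds hbd
    rwa [inv_div_inv] at this
  · refine le_kappa fun n t c C h => ?_
    have h1 := norm_sum_le_of_hasLipschitzBounds hfin hG hx₀ (fun i x hx => (hK x).1 hx i) h w
    rw [← adjoint_toEuclideanLin_apply, ← hT, hw] at h1
    have hob' : ∀ i j, i ≠ j → inner ℝ (row A i) (row A j) ≤ (0 : ℝ) := by
      intro i j hij
      rcases hob i j hij with h | h
      · exact h.le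
      · linarith
    -- Recolouring does not affect absolute values, so the obtuse estimate may be applied to the
    -- recoloured `w`, whose combination has squared norm `(2 - M²) ‖w‖² = m² ‖w‖²`.
    have h2 : ‖∑ i, |w i| • row A i‖ ≤ m * ‖w‖ := by
      refine le_of_sq_le_sq ?_ (by positivity)
      have h3 := norm_sq_sum_abs_le hob' fun i => ε i * w i
      have h4 := hcol w
      rw [hT, adjoint_toEuclideanLin_apply, ← hT, hw] at h4
      have h5 : ∀ i, |ε i * w i| = |w i| := by
        intro i
        rcases hε i with h | h <;> simp [h]
      simp only [h5] at h3
      have h6 : m ^ 2 = 2 - M ^ 2 := by linarith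
      rw [mul_pow, h6]
      refine h3.trans (h4.le.trans ?_)
      rw [mul_pow]; linarith
    rw [div_le_div_iff₀ hm h.1]
    have hw1 := norm_pos_iff.2 hw0
    refine le_of_mul_le_mul_right ?_ hw1
    have h7 := mul_le_mul_of_nonneg_left h2 h.2.1
    linarith

end Essential

/-! ### Attained extrema over orbits, and the zero orbit -/

section FiniteGroups

variable {V : Type*} [NormedAddCommGroup V] [InnerProductSpace ℝ V] {G : Subgroup (O V)}

theorem orbit_finite (hfin : Finite G) (x : V) : (orbit G x).Finite := by
  have : orbit G x = Set.range fun g : G => (g : O V) x := by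
    ext y; simp [orbit]
  rw [this]
  exact Set.finite_range _

theorem exists_maxFilter_eq (hfin : Finite G) (x y : V) :
    ∃ p ∈ orbit G x, ∃ q ∈ orbit G y, maxFilter G x y = inner ℝ p q ∧
      ∀ p' ∈ orbit G x, ∀ q' ∈ orbit G y, inner ℝ p' q' ≤ (inner ℝ p q : ℝ) := by
  obtain ⟨⟨p, q⟩, ⟨hp, hq⟩, hmax⟩ := Set.exists_max_image (orbit G x ×ˢ orbit G y)
    (fun z => (inner ℝ z.1 z.2 : ℝ)) ((orbit_finite hfin x).prod (orbit_finite hfin y))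
    ⟨(x, y), mem_orbit_self x, mem_orbit_self y⟩
  have hm : ∀ p' ∈ orbit G x, ∀ q' ∈ orbit G y, inner ℝ p' q' ≤ (inner ℝ p q : ℝ) :=
    fun p' hp' q' hq' => hmax (p', q') ⟨hp', hq'⟩
  refine ⟨p, hp, q, hq, IsGreatest.csSup_eq ⟨⟨p, hp, q, hq, rfl⟩, ?_⟩, hm⟩
  rintro _ ⟨p', hp', q', hq', rfl⟩
  exact hm p' hp' q' hq'

theorem exists_orbitDist_eq (hfin : Finite G) (x y : V) :
    ∃ p ∈ orbit G x, ∃ q ∈ orbit G y, orbitDist G x y = ‖p - q‖ ∧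
      ∀ p' ∈ orbit G x, ∀ q' ∈ orbit G y, ‖p - q‖ ≤ ‖p' - q'‖ := by
  obtain ⟨⟨p, q⟩, ⟨hp, hq⟩, hmin⟩ := Set.exists_min_image (orbit G x ×ˢ orbit G y)
    (fun z => ‖z.1 - z.2‖) ((orbit_finite hfin x).prod (orbit_finite hfin y))
    ⟨(x, y), mem_orbit_self x, mem_orbit_self y⟩
  have hm : ∀ p' ∈ orbit G x, ∀ q' ∈ orbit G y, ‖p - q‖ ≤ ‖p' - q'‖ :=
    fun p' hp' q' hq' => hmin (p', q') ⟨hp', hq'⟩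
  refine ⟨p, hp, q, hq, IsLeast.csInf_eq ⟨⟨p, hp, q, hq, rfl⟩, ?_⟩, hm⟩
  rintro _ ⟨p', hp', q', hq', rfl⟩
  exact hm p' hp' q' hq'

theorem orbit_zero : orbit G (0 : V) = {0} := by
  ext y
  constructor
  · rintro ⟨g, -, rfl⟩; exact map_zero g
  · rintro rfl; exact mem_orbit_self 0

theorem maxFilter_zero_right (x : V) : maxFilter G x 0 = 0 := by
  refine IsGreatest.csSup_eq ⟨⟨x, mem_orbit_self x, 0, mem_orbit_self 0, by simp⟩, ?_⟩
  rintro _ ⟨p, -, q, hq, rfl⟩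
  rw [orbit_zero] at hq
  rw [hq, inner_zero_right]

theorem maxFilter_zero_left (x : V) : maxFilter G 0 x = 0 := by
  refine IsGreatest.csSup_eq ⟨⟨0, mem_orbit_self 0, x, mem_orbit_self x, by simp⟩, ?_⟩
  rintro _ ⟨p, hp, q, -, rfl⟩
  rw [orbit_zero] at hp
  rw [hp, inner_zero_left]

theorem orbitDist_self (x : V) : orbitDist G x x = 0 := by
  refine IsLeast.csInf_eq ⟨⟨x, mem_orbit_self x, x, mem_orbit_self x, by simp⟩, ?_⟩
  rintro _ ⟨p, -, q, -, rfl⟩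
  exact norm_nonneg _

end FiniteGroups

/-! ### Componentwise actions and the maximum formula -/

section Products

variable {d k : ℕ} {δ : Fin k → ℕ} {G : Subgroup (O (Euc d))}
  {Gi : ∀ i, Subgroup (O (Euc (δ i)))} {e : PiLp 2 (fun i => Euc (δ i)) ≃ₗᵢ[ℝ] Euc d}

/-- The componentwise action of a family of isometries. -/
noncomputable def prodHom (e : PiLp 2 (fun i => Euc (δ i)) ≃ₗᵢ[ℝ] Euc d) :
    (∀ i, O (Euc (δ i))) →* O (Euc d) where
  toFun h := e.symm.trans ((LinearIsometryEquiv.piLpCongrRight 2 h).trans e)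
  map_one' := by
    ext1 x
    exact e.apply_symm_apply x
  map_mul' g h := by
    ext1 x
    change e _ = e (LinearIsometryEquiv.piLpCongrRight 2 g (e.symm (e _)))
    rw [e.symm_apply_apply]
    rfl

theorem symm_prodHom_apply (h : ∀ i, O (Euc (δ i))) (x : Euc d) (i : Fin k) :
    e.symm (prodHom e h x) i = h i (e.symm x i) := by
  change e.symm (e (LinearIsometryEquiv.piLpCongrRight 2 h (e.symm x))) i = _
  rw [e.symm_apply_apply]
  rfl

theorem ext_components {x y : Euc d} (h : ∀ i, e.symm x i = e.symm y i) : x = y :=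
  e.symm.injective (PiLp.ext h)

theorem isDirectProduct_iff : IsDirectProduct G Gi e ↔
    ∀ g, g ∈ G ↔ ∃ h : ∀ i, O (Euc (δ i)), (∀ i, h i ∈ Gi i) ∧ prodHom e h = g := by
  refine forall_congr' fun g => iff_congr Iff.rfl (exists_congr fun h => and_congr_right fun _ => ?_)
  constructor
  · intro hx
    ext1 x
    refine ext_components (e := e) fun i => ?_
    rw [symm_prodHom_apply, ← hx, e.apply_symm_apply]
  · rintro rfl x i
    rw [symm_prodHom_apply, e.symm_apply_apply]

theorem inner_eq_sum_components (x y : Euc d) :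
    inner ℝ x y = ∑ i, inner ℝ (e.symm x i) (e.symm y i) := by
  rw [← e.symm.inner_map_map, PiLp.inner_apply]

theorem norm_sq_eq_sum_components (x : Euc d) : ‖x‖ ^ 2 = ∑ i, ‖e.symm x i‖ ^ 2 := by
  rw [← e.symm.norm_map, PiLp.norm_sq_eq_of_L2]

namespace IsDirectProduct

theorem mem_orbit_iff (hp : IsDirectProduct G Gi e) (x y : Euc d) :
    y ∈ orbit G x ↔ ∀ i, e.symm y i ∈ orbit (Gi i) (e.symm x i) := by
  rw [isDirectProduct_iff] at hp
  constructor
  · rintro ⟨g, hg, rfl⟩ i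
    obtain ⟨h, hh, rfl⟩ := (hp g).1 hg
    exact ⟨h i, hh i, (symm_prodHom_apply h x i).symm⟩
  · intro hy
    choose h hh hhy using hy
    refine ⟨prodHom e h, (hp _).2 ⟨h, hh, rfl⟩, ?_⟩
    refine ext_components (e := e) fun i => ?_
    rw [symm_prodHom_apply, hhy]

theorem exists_mem_orbit (hp : IsDirectProduct G Gi e) {x : Euc d} (p : ∀ i, Euc (δ i))
    (h : ∀ i, p i ∈ orbit (Gi i) (e.symm x i)) :
    ∃ y ∈ orbit G x, ∀ i, e.symm y i = p i := by
  have hy : ∀ i, e.symm (e (WithLp.toLp 2 p)) i = p i := fun i => by rw [e.symm_apply_apply]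
  exact ⟨e (WithLp.toLp 2 p), (hp.mem_orbit_iff _ _).2 fun i => by rw [hy]; exact h i, hy⟩

theorem finite_component (hp : IsDirectProduct G Gi e) (hfin : Finite G) (i : Fin k) :
    Finite (Gi i) := by
  classical
  have hmem : ∀ h : Gi i, prodHom e (Pi.mulSingle i (h : O (Euc (δ i)))) ∈ G := by
    intro h
    refine (isDirectProduct_iff.1 hp _).2 ⟨_, fun j => ?_, rfl⟩
    by_cases hj : j = i
    · subst hj; simp
    · rw [Pi.mulSingle_eq_of_ne hj]; exact (Gi j).one_mem
  refine Finite.of_injective (fun h : Gi i => (⟨_, hmem h⟩ : G)) fun a b hab => ?_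
  have h1 : prodHom e (Pi.mulSingle i (a : O (Euc (δ i)))) =
    prodHom e (Pi.mulSingle i (b : O (Euc (δ i)))) := congrArg Subtype.val hab
  ext1
  ext1 x
  have h2 := congrArg (fun g : O (Euc d) => e.symm (g (e (PiLp.single 2 i x))) i) h1
  simpa [symm_prodHom_apply] using h2

/-- Orbits of the product are products of orbits, so the maxima in the summands can be attained
simultaneously. -/
theorem maxFilter_eq_sum (hp : IsDirectProduct G Gi e) (hfin : Finite G) (x y : Euc d) :
    maxFilter G x y = ∑ i, maxFilter (Gi i) (e.symm x i) (e.symm y i) := by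
  choose p hpo q hq heq hmax using fun i =>
    exists_maxFilter_eq (hp.finite_component hfin i) (e.symm x i) (e.symm y i)
  obtain ⟨p', hp', hpe⟩ := hp.exists_mem_orbit p hpo
  obtain ⟨q', hq', hqe⟩ := hp.exists_mem_orbit q hq
  simp only [heq]
  refine IsGreatest.csSup_eq ⟨⟨p', hp', q', hq', ?_⟩, ?_⟩
  · rw [inner_eq_sum_components (e := e)]; simp only [hpe, hqe]
  · rintro _ ⟨a, ha, b, hb, rfl⟩
    rw [inner_eq_sum_components (e := e)]
    exact Finset.sum_le_sum fun i _ =>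
      hmax i _ ((hp.mem_orbit_iff _ _).1 ha i) _ ((hp.mem_orbit_iff _ _).1 hb i)

theorem orbitDist_sq_eq_sum (hp : IsDirectProduct G Gi e) (hfin : Finite G) (x y : Euc d) :
    orbitDist G x y ^ 2 = ∑ i, orbitDist (Gi i) (e.symm x i) (e.symm y i) ^ 2 := by
  choose p hpo q hq heq hmin using fun i =>
    exists_orbitDist_eq (hp.finite_component hfin i) (e.symm x i) (e.symm y i)
  obtain ⟨p', hp', hpe⟩ := hp.exists_mem_orbit p hpo
  obtain ⟨q', hq', hqe⟩ := hp.exists_mem_orbit q hq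
  have h1 : orbitDist G x y = ‖p' - q'‖ := by
    refine IsLeast.csInf_eq ⟨⟨p', hp', q', hq', rfl⟩, ?_⟩
    rintro _ ⟨a, ha, b, hb, rfl⟩
    refine le_of_sq_le_sq ?_ (norm_nonneg _)
    rw [norm_sq_eq_sum_components (e := e), norm_sq_eq_sum_components (e := e) (a - b)]
    refine Finset.sum_le_sum fun i _ => pow_le_pow_left₀ (norm_nonneg _) ?_ 2
    simp only [map_sub, PiLp.sub_apply, hpe, hqe]
    exact hmin i _ ((hp.mem_orbit_iff _ _).1 ha i) _ ((hp.mem_orbit_iff _ _).1 hb i)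
  rw [h1, norm_sq_eq_sum_components (e := e)]
  simp only [map_sub, PiLp.sub_apply, hpe, hqe, heq]

theorem maxFilter_single_right (hp : IsDirectProduct G Gi e) (hfin : Finite G) (i : Fin k)
    (x : Euc d) (y : Euc (δ i)) :
    maxFilter G x (e (PiLp.single 2 i y)) = maxFilter (Gi i) (e.symm x i) y := by
  rw [hp.maxFilter_eq_sum hfin, e.symm_apply_apply, Finset.sum_eq_single_of_mem i (Finset.mem_univ i)]
  · simp
  · intro j _ hj
    rw [PiLp.single_eq_of_ne _ hj, maxFilter_zero_right]

theorem maxFilter_single_left (hp : IsDirectProduct G Gi e) (hfin : Finite G) (i : Fin k)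
    (x : Euc d) (y : Euc (δ i)) :
    maxFilter G (e (PiLp.single 2 i y)) x = maxFilter (Gi i) y (e.symm x i) := by
  rw [hp.maxFilter_eq_sum hfin, e.symm_apply_apply, Finset.sum_eq_single_of_mem i (Finset.mem_univ i)]
  · simp
  · intro j _ hj
    rw [PiLp.single_eq_of_ne _ hj, maxFilter_zero_left]

theorem orbitDist_single (hp : IsDirectProduct G Gi e) (hfin : Finite G) (i : Fin k)
    (x y : Euc (δ i)) :
    orbitDist G (e (PiLp.single 2 i x)) (e (PiLp.single 2 i y)) = orbitDist (Gi i) x y := by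
  rw [← sq_eq_sq₀ (orbitDist_nonneg _ _) (orbitDist_nonneg _ _), hp.orbitDist_sq_eq_sum hfin,
    e.symm_apply_apply, e.symm_apply_apply, Finset.sum_eq_single_of_mem i (Finset.mem_univ i)]
  · simp
  · intro j _ hj
    rw [PiLp.single_eq_of_ne _ hj, PiLp.single_eq_of_ne _ hj, orbitDist_self, sq, zero_mul]

/-- On points supported in the `i`-th summand, a template acts only through its `i`-th component, so
the components inherit both bounds. -/
theorem kappa_component_le (hp : IsDirectProduct G Gi e) (hfin : Finite G) (i : Fin k) :
    kappa (Gi i) ≤ kappa G := by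
  refine le_sInf ?_
  rintro _ ⟨n, t, c, C, h, rfl⟩
  refine sInf_le ⟨n, fun j => e.symm (t j) i, c, C, ?_, rfl⟩
  rw [hasLipschitzBounds_iff_sq orbitDist_nonneg] at h ⊢
  refine ⟨h.1, h.2.1, fun x y => ?_⟩
  have := h.2.2 (e (PiLp.single 2 i x)) (e (PiLp.single 2 i y))
  simpa only [hp.maxFilter_single_right hfin, hp.orbitDist_single hfin] using this

theorem hasLipschitzBounds_directSum (hp : IsDirectProduct G Gi e) (hfin : Finite G)
    {t : ∀ i, Fin (δ i) → Euc (δ i)} {c C : ℝ} (hc : 0 < c) (hC : 0 ≤ C) {ci Ci : Fin k → ℝ}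
    (h : ∀ i, HasLipschitzBounds (Gi i) (t i) (ci i) (Ci i)) (hci : ∀ i, c ≤ ci i)
    (hCi : ∀ i, Ci i ≤ C) : HasLipschitzBounds G (directSum e t) c C := by
  rw [hasLipschitzBounds_iff_sq orbitDist_nonneg]
  refine ⟨hc, hC, fun x y => ?_⟩
  have hb := fun i => ((hasLipschitzBounds_iff_sq orbitDist_nonneg).1 (h i))
  have hs : ∑ p, (maxFilter G (directSum e t p) x - maxFilter G (directSum e t p) y) ^ 2 =
      ∑ i, ∑ j, (maxFilter (Gi i) (t i j) (e.symm x i) -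
        maxFilter (Gi i) (t i j) (e.symm y i)) ^ 2 := by
    rw [Fintype.sum_sigma]
    refine Finset.sum_congr rfl fun i _ => Finset.sum_congr rfl fun j _ => ?_
    unfold directSum
    rw [hp.maxFilter_single_left hfin, hp.maxFilter_single_left hfin]
  rw [hs, hp.orbitDist_sq_eq_sum hfin, Finset.mul_sum, Finset.mul_sum]
  constructor
  · refine Finset.sum_le_sum fun i _ => le_trans ?_ ((hb i).2.2 _ _).1
    exact mul_le_mul_of_nonneg_right (pow_le_pow_left₀ hc.le (hci i) 2) (sq_nonneg _)
  · refine Finset.sum_le_sum fun i _ => ((hb i).2.2 _ _).2.trans ?_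
    exact mul_le_mul_of_nonneg_right (pow_le_pow_left₀ (hb i).2.1 (hCi i) 2) (sq_nonneg _)

theorem sum_dim (e : PiLp 2 (fun i => Euc (δ i)) ≃ₗᵢ[ℝ] Euc d) : ∑ i, δ i = d := by
  have h1 := e.toLinearEquiv.finrank_eq
  have h2 := (WithLp.linearEquiv 2 ℝ (∀ i, Euc (δ i))).finrank_eq
  rw [finrank_euclideanSpace_fin] at h1
  rw [Module.finrank_pi_fintype] at h2
  simp only [finrank_euclideanSpace_fin] at h2
  exact h2.symm.trans h1

/-- By `m² + M² = 2`, the index `i₀` with the largest `M` also has the smallest `m`. One summand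
thus has both extreme bounds, and their ratio is its own condition number, which is a lower bound
for that of `G`. -/
theorem isMinimalOptimal_directSum (hp : IsDirectProduct G Gi e) (hd : 1 ≤ d) (hfin : Finite G)
    (hG : IsReflectionGroup G) {t : ∀ i, Fin (δ i) → Euc (δ i)} {m M : Fin k → ℝ}
    (h : ∀ i, HasBalancedBounds (Gi i) (t i) (m i) (M i)) :
    kappa G = (⨆ i, kappa (Gi i)) ∧ IsMinimalOptimal G (directSum e t) := by
  have hk : Nonempty (Fin k) := by
    by_contra hcon
    rw [not_nonempty_iff] at hcon
    have := sum_dim e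
    rw [Finset.univ_eq_empty, Finset.sum_empty] at this
    omega
  obtain ⟨i₀, hi₀⟩ := Finite.exists_max M
  obtain ⟨hm₀, hmM₀, hsum₀, -, hk₀⟩ := h i₀
  have hM₀ := hm₀.trans_le hmM₀
  have hbd : HasLipschitzBounds G (directSum e t) (M i₀)⁻¹ (m i₀)⁻¹ := by
    refine hp.hasLipschitzBounds_directSum hfin (inv_pos.2 hM₀) (inv_pos.2 hm₀).le
      (fun i => (h i).2.2.2.1) (fun i => ?_) fun i => ?_
    · exact inv_anti₀ ((h i).1.trans_le (h i).2.1) (hi₀ i)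
    · refine inv_anti₀ hm₀ (le_of_sq_le_sq ?_ (h i).1.le)
      have h1 := pow_le_pow_left₀ ((h i).1.trans_le (h i).2.1).le (hi₀ i) 2
      linarith [(h i).2.2.1]
  have hle : ⨆ i, kappa (Gi i) ≤ kappa G := iSup_le fun i => hp.kappa_component_le hfin i
  have hge : kappa G ≤ kappa (Gi i₀) := by
    rw [hk₀, ← inv_div_inv]
    exact kappa_le_of_hasLipschitzBounds hbd
  have hle₀ := le_iSup (fun i => kappa (Gi i)) i₀
  refine ⟨le_antisymm (hge.trans hle₀) hle, ?_⟩
  refine isMinimalOptimal_of_kappa_eq hfin hG hbd ?_ ?_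
  · rw [inv_div_inv, ← hk₀]
    exact le_antisymm hge (hle₀.trans hle)
  · rw [Fintype.card_sigma, finrank_euclideanSpace_fin]
    simpa using sum_dim e

theorem isEssential_iff (hp : IsDirectProduct G Gi e) :
    IsEssential G ↔ ∀ i, IsEssential (Gi i) := by
  rw [isDirectProduct_iff] at hp
  constructor
  · intro hess i x hx
    have h1 := hess (e (PiLp.single 2 i x)) fun g hg => by
      obtain ⟨h, hh, rfl⟩ := (hp g).1 hg
      refine ext_components (e := e) fun j => ?_
      rw [symm_prodHom_apply, e.symm_apply_apply]
      by_cases hj : j = i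
      · subst hj
        rw [PiLp.single_eq_same]
        exact hx _ (hh _)
      · rw [PiLp.single_eq_of_ne _ hj, map_zero]
    have h2 := congrArg (fun z => e.symm z i) h1
    simpa using h2
  · intro hess x hx
    refine ext_components (e := e) fun i => ?_
    rw [map_zero, PiLp.zero_apply]
    refine hess i _ fun h hh => ?_
    have h1 := hx (prodHom e (Pi.mulSingle i h)) ((hp _).2 ⟨_, fun j => ?_, rfl⟩)
    · have h2 := congrArg (fun z => e.symm z i) h1
      simpa [symm_prodHom_apply] using h2
    · by_cases hj : j = i
      · subst hj; simpa using hh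
      · rw [Pi.mulSingle_eq_of_ne hj]; exact (Gi j).one_mem

end IsDirectProduct

theorem not_isEssential_bot {n : ℕ} (hn : 1 ≤ n) : ¬ IsEssential (⊥ : Subgroup (O (Euc n))) := by
  intro h
  have : Nontrivial (Euc n) := by
    have : Nonempty (Fin n) := ⟨⟨0, hn⟩⟩
    infer_instance
  obtain ⟨x, hx⟩ := exists_ne (0 : Euc n)
  exact hx (h x fun g hg => by rw [Subgroup.mem_bot.1 hg]; rfl)

theorem IsConstituentTemplates.exists_hasBalancedBounds {n : ℕ} (hn : 1 ≤ n)
    {H : Subgroup (O (Euc n))} (hfin : Finite H) (hH : IsReflectionGroup H)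
    {t : Fin n → Euc n} (ht : IsConstituentTemplates H t) :
    ∃ m M, HasBalancedBounds H t m M := by
  rcases ht with ⟨rfl, b, rfl⟩ | ⟨-, -, A, hA, rfl⟩
  · have : Nonempty (Fin n) := ⟨⟨0, hn⟩⟩
    -- An orthonormal basis is a tight frame with bound one, hence balanced.
    refine ⟨1, 1, one_pos, le_rfl, by norm_num, ?_, by rw [kappa_bot]; simp⟩
    simpa using bot_orthonormalBasis b
  · exact ⟨_, _, (hasBalancedBounds_of_isFundamentalSystem hn hfin hH hA).2⟩

theorem exists_isConstituentTemplates {n : ℕ} {H : Subgroup (O (Euc n))} (hfin : Finite H)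
    (hH : IsReflectionGroup H) (h : H = ⊥ ∨ (IsEssential H ∧ IsIrreducible H)) :
    ∃ t : Fin n → Euc n, IsConstituentTemplates H t := by
  rcases h with h | ⟨h1, h2⟩
  · exact ⟨_, Or.inl ⟨h, EuclideanSpace.basisFun (Fin n) ℝ, rfl⟩⟩
  · obtain ⟨α, hα⟩ := exists_isFundamentalSystem hfin hH h1 (finrank_euclideanSpace_fin (n := n))
    exact ⟨_, Or.inr ⟨h1, h2, Matrix.of fun i j => α i j, hα, rfl⟩⟩

theorem IsConstituentDecomposition.properties (hd : 1 ≤ d) (hfin : Finite G)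
    (hG : IsReflectionGroup G) (h : IsConstituentDecomposition G Gi e) :
    ((∃ i, Gi i = ⊥) ↔ ¬ IsEssential G) ∧ kappa G = (⨆ i, kappa (Gi i)) ∧
      ∀ t : ∀ i, Fin (δ i) → Euc (δ i), (∀ i, IsConstituentTemplates (Gi i) (t i)) →
        IsMinimalOptimal G (directSum e t) := by
  obtain ⟨hδ, hp, hi⟩ := h
  have hf := hp.finite_component hfin
  have key : ∀ t : ∀ i, Fin (δ i) → Euc (δ i), (∀ i, IsConstituentTemplates (Gi i) (t i)) →
      kappa G = (⨆ i, kappa (Gi i)) ∧ IsMinimalOptimal G (directSum e t) := by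
    intro t ht
    choose m M hmM using fun i => (ht i).exists_hasBalancedBounds (hδ i) (hf i) (hi i).1
    exact hp.isMinimalOptimal_directSum hd hfin hG hmM
  refine ⟨?_, ?_, fun t ht => (key t ht).2⟩
  · rw [hp.isEssential_iff]
    constructor
    · rintro ⟨i, hbot⟩ hess
      have := hess i
      rw [hbot] at this
      exact not_isEssential_bot (hδ i) this
    · intro hne
      by_contra! hcon
      exact hne fun i => ((hi i).2.resolve_left (hcon i)).1
  · choose t ht using fun i => exists_isConstituentTemplates (hf i) (hi i).1 (hi i).2
    exact (key t ht).1

end Products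

/-! ### Reflections in a direct product of reflection groups -/

section CommutingReflectionGroups

variable {V : Type*} [NormedAddCommGroup V] [InnerProductSpace ℝ V] {H K : Subgroup (O V)}

theorem IsReflectionGroup.exists_mem_roots (hH : IsReflectionGroup H) (hne : H ≠ ⊥) :
    ∃ u, u ∈ roots H := by
  by_contra! hcon
  refine hne (eq_bot_iff.2 ((closure_refl_roots hH).trans ?_))
  rw [Subgroup.closure_le]
  rintro _ ⟨u, hu, rfl⟩
  exact absurd hu (hcon u)

/-- Since `refl w` commutes with `refl v`, it maps `v` to `v` or `-v`. The first case is
orthogonality; in the second, `v` is parallel to `w`, and the common reflection lies in `H ⊓ K`. -/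
theorem inner_roots_eq_zero (hcomm : ∀ h ∈ H, ∀ k ∈ K, h * k = k * h) (hinf : H ⊓ K = ⊥)
    {v w : V} (hv : v ∈ roots H) (hw : w ∈ roots K) : inner ℝ v w = (0 : ℝ) := by
  have h1 : refl (refl w v) = refl v := by
    rw [refl_map, ← hcomm _ hv.2 _ hw.2, mul_assoc, mul_inv_cancel, mul_one]
  rcases (refl_eq_iff (by rw [(refl w).norm_map, hv.1]) hv.1).1 h1 with h2 | h2
  · rw [real_inner_comm]
    exact (refl_fix_iff w v).1 h2
  · exfalso
    rw [refl_apply_of_norm hw.1] at h2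
    have h3 : v = (inner ℝ w v : ℝ) • w := by
      have h4 : (2 : ℝ) • v = (2 : ℝ) • ((inner ℝ w v : ℝ) • w) := by
        rw [smul_smul, two_smul]
        have := congrArg (fun z => z + (2 * inner ℝ w v : ℝ) • w + v) h2
        simpa using this
      exact smul_right_injective V (two_ne_zero' ℝ) h4
    have hv0 := ne_zero_of_norm_eq_one hv.1
    have h5 : (inner ℝ w v : ℝ) ≠ 0 := by
      intro h0
      rw [h0, zero_smul] at h3
      exact hv0 h3
    have h6 : refl v = refl w := by
      conv_lhs => rw [h3]
      exact refl_smul h5 w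
    have h7 : refl v ∈ H ⊓ K := ⟨hv.2, h6 ▸ hw.2⟩
    rw [hinf] at h7
    exact refl_ne_one hv0 (Subgroup.mem_bot.1 h7)

theorem IsReflectionGroup.map_eq_self (hH : IsReflectionGroup H) {x : V}
    (hx : ∀ v ∈ roots H, inner ℝ v x = (0 : ℝ)) {h : O V} (hh : h ∈ H) : h x = x := by
  refine closure_fix (fun s hs => ?_) (closure_refl_roots hH hh)
  obtain ⟨u, hu, rfl⟩ := hs
  exact (refl_fix_iff u x).2 (hx u hu)

/-- A reflection group fixes the orthogonal complement of its roots pointwise, so only the span of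
the roots matters. -/
theorem IsReflectionGroup.eq_one_of_fix_roots [FiniteDimensional ℝ V] (hH : IsReflectionGroup H)
    {h : O V} (hh : h ∈ H) (hfix : ∀ v ∈ roots H, h v = v) : h = 1 := by
  ext1 x
  obtain ⟨p, hp, q, hq, rfl⟩ := (Submodule.span ℝ (roots H)).exists_add_mem_mem_orthogonal x
  have h1 : h q = q := hH.map_eq_self (fun v hv => hq v (Submodule.subset_span hv)) hh
  have h2 : h p = p := by
    induction hp using Submodule.span_induction with
    | mem v hv => exact hfix v hv
    | zero => exact map_zero h
    | add a b _ _ ha hb => rw [map_add, ha, hb]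
    | smul c a _ ha => rw [map_smul, ha]
  rw [map_add, h1, h2]
  rfl

theorem exists_mul_eq_of_mem_sup (hcomm : ∀ h ∈ H, ∀ k ∈ K, h * k = k * h) {g : O V}
    (hg : g ∈ H ⊔ K) : ∃ h ∈ H, ∃ k ∈ K, g = h * k := by
  rw [Subgroup.sup_eq_closure] at hg
  induction hg using Subgroup.closure_induction with
  | mem g hg =>
    rcases hg with hg | hg
    · exact ⟨g, hg, 1, K.one_mem, (mul_one g).symm⟩
    · exact ⟨1, H.one_mem, g, hg, (one_mul g).symm⟩
  | one => exact ⟨1, H.one_mem, 1, K.one_mem, (mul_one 1).symm⟩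
  | mul a b _ _ ha hb =>
    obtain ⟨h, hh, k, hk, rfl⟩ := ha
    obtain ⟨h', hh', k', hk', rfl⟩ := hb
    refine ⟨h * h', H.mul_mem hh hh', k * k', K.mul_mem hk hk', ?_⟩
    rw [mul_assoc, ← mul_assoc k, ← hcomm _ hh' _ hk]
    simp only [mul_assoc]
  | inv a _ ha =>
    obtain ⟨h, hh, k, hk, rfl⟩ := ha
    refine ⟨h⁻¹, H.inv_mem hh, k⁻¹, K.inv_mem hk, ?_⟩
    rw [hcomm _ hh _ hk, mul_inv_rev]

/-- A reflection in a product of two reflection groups belongs to one of them. -/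
theorem refl_mem_or_mem [FiniteDimensional ℝ V] (hH : IsReflectionGroup H)
    (hK : IsReflectionGroup K) (hcomm : ∀ h ∈ H, ∀ k ∈ K, h * k = k * h) (hinf : H ⊓ K = ⊥)
    {u : V} (hu : refl u ∈ H ⊔ K) : refl u ∈ H ∨ refl u ∈ K := by
  obtain ⟨h, hh, k, hk, hg⟩ := exists_mul_eq_of_mem_sup hcomm hu
  have horth : ∀ v ∈ roots H, ∀ w ∈ roots K, inner ℝ v w = (0 : ℝ) := fun v hv w hw =>
    inner_roots_eq_zero hcomm hinf hv hw
  have hkv : ∀ v ∈ roots H, refl u v = h v := by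
    intro v hv
    rw [hg]
    change h (k v) = h v
    rw [hK.map_eq_self (fun w hw => by rw [real_inner_comm]; exact horth v hv w hw) hk]
  have hhw : ∀ w ∈ roots K, refl u w = k w := by
    intro w hw
    rw [hg, hcomm _ hh _ hk]
    change k (h w) = k w
    rw [hH.map_eq_self (fun v hv => horth v hv w hw) hh]
  -- If `u` is not orthogonal to a root `v` of `H`, then `h v` is `v` minus a nonzero multiple of
  -- `u`. As `v` and `h v` are orthogonal to the roots of `K`, so is `u`; hence `k` fixes these
  -- roots and is trivial. Otherwise `h` fixes the roots of `H` and is trivial.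
  by_cases hex : ∃ v ∈ roots H, inner ℝ u v ≠ (0 : ℝ)
  · left
    obtain ⟨v, hv, h0⟩ := hex
    have hu0 : u ≠ 0 := by rintro rfl; simp at h0
    have h1 := hkv v hv
    rw [refl_apply] at h1
    have hc : (2 * (inner ℝ u v / ‖u‖ ^ 2) : ℝ) ≠ 0 := by
      have := norm_ne_zero_iff.2 hu0
      positivity
    have huw : ∀ w ∈ roots K, inner ℝ u w = (0 : ℝ) := by
      intro w hw
      have h2 := congrArg (fun z => (inner ℝ z w : ℝ)) h1
      simp only [inner_sub_left, inner_smul_left, horth v hv w hw,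
        horth _ (map_mem_roots hh hv) w hw, conj_trivial, zero_sub, neg_eq_zero] at h2
      exact (mul_eq_zero.1 h2).resolve_left hc
    have hk1 : k = 1 := hK.eq_one_of_fix_roots hk fun w hw => by
      rw [← hhw w hw]; exact (refl_fix_iff u w).2 (huw w hw)
    rw [hg, hk1, mul_one]
    exact hh
  · right
    push Not at hex
    have hh1 : h = 1 := hH.eq_one_of_fix_roots hh fun v hv => by
      rw [← hkv v hv]; exact (refl_fix_iff u v).2 (hex v hv)
    rw [hg, hh1, one_mul]
    exact hk

end CommutingReflectionGroups

/-! ### Decomposition along linkage classes of roots -/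

section Decomposition

open Module

variable {d k : ℕ}

theorem exists_isometry_of_orthogonal (W : Fin k → Submodule ℝ (Euc d))
    (horth : ∀ i j, i ≠ j → W i ⟂ W j) (htop : ∀ x, (∀ i, x ∈ (W i)ᗮ) → x = 0) :
    ∃ e : PiLp 2 (fun i => Euc (finrank ℝ (W i))) ≃ₗᵢ[ℝ] Euc d,
      (∀ i v, e (PiLp.single 2 i v) ∈ W i) ∧ ∀ i, ∀ u ∈ W i, ∃ v, e (PiLp.single 2 i v) = u := by
  have hfam : OrthogonalFamily ℝ (fun i => W i) fun i => (W i).subtypeₗᵢ :=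
    fun i j hij v w => (horth i j hij).inner_eq v.2 w.2
  have hint : DirectSum.IsInternal W := by
    rw [hfam.isInternal_iff, Submodule.eq_bot_iff]
    intro x hx
    rw [← Submodule.iInf_orthogonal, Submodule.mem_iInf] at hx
    exact htop x hx
  let b := fun i => stdOrthonormalBasis ℝ (W i)
  let e := (LinearIsometryEquiv.piLpCongrRight 2 fun i => (b i).repr.symm).trans
    (hint.isometryL2OfOrthogonalFamily hfam).symm
  have he : ∀ i v, e (PiLp.single 2 i v) = ((b i).repr.symm v : Euc d) := by
    intro i v
    change (hint.isometryL2OfOrthogonalFamily hfam).symm _ = _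
    rw [hint.isometryL2OfOrthogonalFamily_symm_apply hfam,
      Finset.sum_eq_single_of_mem i (Finset.mem_univ i)]
    · simp
    · intro j _ hj
      simp [PiLp.single_eq_of_ne _ hj]
  refine ⟨e, fun i v => by rw [he]; exact Subtype.property _, fun i u hu => ?_⟩
  exact ⟨(b i).repr ⟨u, hu⟩, by rw [he, LinearIsometryEquiv.symm_apply_apply]⟩

variable {δ : Fin k → ℕ} {G : Subgroup (O (Euc d))}
  {e : PiLp 2 (fun i => Euc (δ i)) ≃ₗᵢ[ℝ] Euc d}

/-- The subgroup of `O(δ i)` generated by the reflections in the `i`-th summand that belong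
to `G`. -/
noncomputable def component (G : Subgroup (O (Euc d))) (e : PiLp 2 (fun i => Euc (δ i)) ≃ₗᵢ[ℝ] Euc d)
    (i : Fin k) : Subgroup (O (Euc (δ i))) :=
  Subgroup.closure {g | ∃ v, v ≠ 0 ∧ refl (e (PiLp.single 2 i v)) ∈ G ∧ g = refl v}

theorem isReflectionGroup_component (i : Fin k) : IsReflectionGroup (component G e i) := by
  refine ⟨_, ?_, rfl⟩
  rintro _ ⟨v, hv, -, rfl⟩
  exact ⟨v, hv, rfl⟩

theorem inner_single_left (i : Fin k) (v : Euc (δ i)) (x : Euc d) :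
    inner ℝ (e (PiLp.single 2 i v)) x = (inner ℝ v (e.symm x i) : ℝ) := by
  rw [inner_eq_sum_components (e := e), e.symm_apply_apply,
    Finset.sum_eq_single_of_mem i (Finset.mem_univ i)]
  · rw [PiLp.single_eq_same]
  · intro j _ hj
    rw [PiLp.single_eq_of_ne _ hj, inner_zero_left]

theorem prodHom_mulSingle_refl (i : Fin k) (v : Euc (δ i)) :
    prodHom e (Pi.mulSingle i (refl v)) = refl (e (PiLp.single 2 i v)) := by
  ext1 x
  refine ext_components (e := e) fun j => ?_
  rw [symm_prodHom_apply, refl_apply, inner_single_left, map_sub, map_smul, e.symm_apply_apply,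
    PiLp.sub_apply, PiLp.smul_apply, e.norm_map, PiLp.norm_single]
  by_cases hj : j = i
  · subst hj
    rw [Pi.mulSingle_eq_same, PiLp.single_eq_same, refl_apply]
  · rw [Pi.mulSingle_eq_of_ne hj, PiLp.single_eq_of_ne _ hj, smul_zero, sub_zero]
    rfl

/-- Every generating reflection has its root in a single summand, so it acts there as a reflection
and trivially on the other summands. -/
theorem isDirectProduct_component (hG : IsReflectionGroup G)
    (hroots : ∀ u ∈ roots G, ∃ i v, e (PiLp.single 2 i v) = u) :
    IsDirectProduct G (component G e) e := by
  rw [isDirectProduct_iff]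
  intro g
  constructor
  · intro hg
    have hg' := closure_refl_roots hG hg
    clear hg
    induction hg' using Subgroup.closure_induction with
    | mem g hg =>
      obtain ⟨u, hu, rfl⟩ := hg
      obtain ⟨i, v, rfl⟩ := hroots u hu
      refine ⟨Pi.mulSingle i (refl v), fun j => ?_, prodHom_mulSingle_refl i v⟩
      by_cases hj : j = i
      · subst hj
        rw [Pi.mulSingle_eq_same]
        refine Subgroup.subset_closure ⟨v, ?_, hu.2, rfl⟩
        rintro rfl
        have := hu.1
        simp at this
      · rw [Pi.mulSingle_eq_of_ne hj]; exact Subgroup.one_mem _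
    | one => exact ⟨1, fun i => Subgroup.one_mem _, map_one _⟩
    | mul a b _ _ ha hb =>
      obtain ⟨h, hh, rfl⟩ := ha
      obtain ⟨h', hh', rfl⟩ := hb
      exact ⟨h * h', fun i => Subgroup.mul_mem _ (hh i) (hh' i), map_mul _ _ _⟩
    | inv a _ ha =>
      obtain ⟨h, hh, rfl⟩ := ha
      exact ⟨h⁻¹, fun i => Subgroup.inv_mem _ (hh i), map_inv _ _⟩
  · rintro ⟨h, hh, rfl⟩
    have hle : ∀ i, component G e i ≤
        G.comap ((prodHom e).comp (MonoidHom.mulSingle (fun i => O (Euc (δ i))) i)) := by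
      intro i
      refine (Subgroup.closure_le _).2 ?_
      rintro _ ⟨v, -, hv, rfl⟩
      change prodHom e (Pi.mulSingle i (refl v)) ∈ G
      rwa [prodHom_mulSingle_refl]
    have := Subgroup.pi_mem_of_mulSingle_mem (H := G.comap (prodHom e)) h fun i => hle i (hh i)
    exact this

/-- Two roots are linked if they are joined by a chain of roots of which no two consecutive ones are
orthogonal. -/
def Linked {V : Type*} [NormedAddCommGroup V] [InnerProductSpace ℝ V] (G : Subgroup (O V)) :
    V → V → Prop :=
  Relation.EqvGen fun u v => u ∈ roots G ∧ v ∈ roots G ∧ inner ℝ u v ≠ (0 : ℝ)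

/-- The span of the roots that are linked to `u`. -/
def linkedSpan {V : Type*} [NormedAddCommGroup V] [InnerProductSpace ℝ V] (G : Subgroup (O V))
    (u : V) : Submodule ℝ V :=
  Submodule.span ℝ {v | v ∈ roots G ∧ Linked G u v}

section Linked

variable {V : Type*} [NormedAddCommGroup V] [InnerProductSpace ℝ V] {G : Subgroup (O V)}

theorem mem_linkedSpan_self {u : V} (hu : u ∈ roots G) : u ∈ linkedSpan G u :=
  Submodule.subset_span ⟨hu, Relation.EqvGen.refl u⟩

theorem linkedSpan_congr {u v : V} (h : Linked G u v) : linkedSpan G u = linkedSpan G v := by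
  unfold linkedSpan
  congr 1
  ext w
  exact and_congr_right fun _ => ⟨fun h' => (h.symm _ _).trans _ _ _ h', fun h' => h.trans _ _ _ h'⟩

/-- Two non-orthogonal roots, one from each class, would link the classes. -/
theorem isOrtho_linkedSpan {u v : V} (h : ¬ Linked G u v) : linkedSpan G u ⟂ linkedSpan G v := by
  unfold linkedSpan
  rw [Submodule.isOrtho_span]
  rintro a ⟨ha, hua⟩ b ⟨hb, hvb⟩
  by_contra h0
  exact h (((hua.trans _ _ _ (Relation.EqvGen.rel _ _ ⟨ha, hb, h0⟩))).trans _ _ _ (hvb.symm _ _))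

theorem linked_of_mem_linkedSpan {u v : V} (hv : v ∈ roots G) (h : v ∈ linkedSpan G u) :
    Linked G u v := by
  by_contra hcon
  have := (isOrtho_linkedSpan hcon).inner_eq h (mem_linkedSpan_self hv)
  exact ne_zero_of_norm_eq_one hv.1 (inner_self_eq_zero.1 this)

end Linked

theorem single_mem_roots {i : Fin k} {v : Euc (δ i)}
    (hp : IsDirectProduct G (component G e) e) (hv : v ∈ roots (component G e i)) :
    e (PiLp.single 2 i v) ∈ roots G := by
  refine ⟨by rw [e.norm_map, PiLp.norm_single, hv.1], ?_⟩
  rw [← prodHom_mulSingle_refl]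
  refine (isDirectProduct_iff.1 hp _).2 ⟨_, fun j => ?_, rfl⟩
  by_cases hj : j = i
  · subst hj; rw [Pi.mulSingle_eq_same]; exact hv.2
  · rw [Pi.mulSingle_eq_of_ne hj]; exact Subgroup.one_mem _

theorem mem_roots_component {i : Fin k} {v : Euc (δ i)} (h : e (PiLp.single 2 i v) ∈ roots G) :
    v ∈ roots (component G e i) := by
  have h1 : ‖v‖ = 1 := by
    have := h.1
    rwa [e.norm_map, PiLp.norm_single] at this
  exact ⟨h1, Subgroup.subset_closure ⟨v, ne_zero_of_norm_eq_one h1, h.2, rfl⟩⟩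

/-- A fixed vector is orthogonal to all roots of the class, and these span the summand. -/
theorem isEssential_component {i : Fin k} {u : Euc d}
    (hsub : ∀ v, e (PiLp.single 2 i v) ∈ linkedSpan G u)
    (hsurj : ∀ w ∈ linkedSpan G u, ∃ v, e (PiLp.single 2 i v) = w) :
    IsEssential (component G e i) := by
  intro x hx
  have h1 : e (PiLp.single 2 i x) ∈ (linkedSpan G u)ᗮ := by
    rw [linkedSpan, Submodule.mem_orthogonal]
    intro w hw
    induction hw using Submodule.span_induction with
    | mem w hw =>
      obtain ⟨v, rfl⟩ := hsurj w (Submodule.subset_span hw)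
      rw [inner_single_left, e.symm_apply_apply, PiLp.single_eq_same]
      exact (refl_fix_iff v x).1 (hx _ (mem_roots_component hw.1).2)
    | zero => exact inner_zero_left _
    | add a b _ _ ha hb => rw [inner_add_left, ha, hb, add_zero]
    | smul c a _ ha => rw [inner_smul_left, ha, mul_zero]
  have h2 := Submodule.inner_right_of_mem_orthogonal (hsub x) h1
  have h3 := inner_self_eq_zero.1 h2
  have h4 := congrArg (fun z => e.symm z i) h3
  simpa using h4

/-- In a splitting into `H` and `K`, every root of the component belongs to one factor, and the
roots of `H` are orthogonal to those of `K`. A chain of non-orthogonal roots therefore never leaves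
`H`, although all roots of the component are linked. -/
theorem isIrreducible_component {i : Fin k} {u : Euc d}
    (hp : IsDirectProduct G (component G e) e)
    (hsub : ∀ v, e (PiLp.single 2 i v) ∈ linkedSpan G u)
    (hsurj : ∀ w ∈ linkedSpan G u, ∃ v, e (PiLp.single 2 i v) = w) :
    IsIrreducible (component G e i) := by
  rintro ⟨H, K, hH, hK, hH1, hK1, hcomm, hinf, hsup⟩
  obtain ⟨a, ha⟩ := hH.exists_mem_roots hH1
  obtain ⟨b, hb⟩ := hK.exists_mem_roots hK1
  have hHle : H ≤ component G e i := hsup ▸ le_sup_left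
  have hKle : K ≤ component G e i := hsup ▸ le_sup_right
  have ha' := single_mem_roots hp ⟨ha.1, hHle ha.2⟩
  have hb' := single_mem_roots hp ⟨hb.1, hKle hb.2⟩
  have hab : Linked G (e (PiLp.single 2 i a)) (e (PiLp.single 2 i b)) :=
    ((linked_of_mem_linkedSpan ha' (hsub a)).symm _ _).trans _ _ _
      (linked_of_mem_linkedSpan hb' (hsub b))
  have hor : ∀ v, e (PiLp.single 2 i v) ∈ roots G → v ∈ roots H ∨ v ∈ roots K := by
    intro v hv
    have hv' := mem_roots_component hv
    have := hv'.2
    rw [← hsup] at this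
    exact (refl_mem_or_mem hH hK hcomm hinf this).imp (fun h => ⟨hv'.1, h⟩) fun h => ⟨hv'.1, h⟩
  have horth : ∀ v ∈ roots H, ∀ w ∈ roots K, inner ℝ v w = (0 : ℝ) := fun v hv w hw =>
    inner_roots_eq_zero hcomm hinf hv hw
  have hstep : ∀ x y, x ∈ roots G → y ∈ roots G → inner ℝ x y ≠ (0 : ℝ) →
      (∃ v ∈ roots H, e (PiLp.single 2 i v) = x) → ∃ v ∈ roots H, e (PiLp.single 2 i v) = y := by
    rintro _ y hx hy h0 ⟨v, hv, rfl⟩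
    have hly : Linked G u y := (linked_of_mem_linkedSpan hx (hsub v)).trans _ _ _
      (Relation.EqvGen.rel _ _ ⟨hx, hy, h0⟩)
    obtain ⟨w, rfl⟩ := hsurj y (Submodule.subset_span ⟨hy, hly⟩)
    refine ⟨w, (hor w hy).resolve_right fun hw => h0 ?_, rfl⟩
    rw [inner_single_left, e.symm_apply_apply, PiLp.single_eq_same]
    exact horth v hv w hw
  have hmem : ∀ x y, Linked G x y →
      ((∃ v ∈ roots H, e (PiLp.single 2 i v) = x) ↔ ∃ v ∈ roots H, e (PiLp.single 2 i v) = y) := by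
    intro x y hxy
    induction hxy with
    | rel x y h =>
      exact ⟨hstep x y h.1 h.2.1 h.2.2, hstep y x h.2.1 h.1 (by rw [real_inner_comm]; exact h.2.2)⟩
    | refl x => exact Iff.rfl
    | symm x y _ ih => exact ih.symm
    | trans x y z _ _ ih ih' => exact ih.trans ih'
  obtain ⟨v, hv, he⟩ := (hmem _ _ hab).1 ⟨a, ha, rfl⟩
  have hvb : v = b := by
    have := congrArg (fun z => e.symm z i) he
    simpa using this
  subst hvb
  have h1 : refl v ∈ H ⊓ K := ⟨hv.2, hb.2⟩
  rw [hinf] at h1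
  exact refl_ne_one (ne_zero_of_norm_eq_one hv.1) (Subgroup.mem_bot.1 h1)

theorem exists_isConstituentDecomposition {G : Subgroup (O (Euc d))} (hfin : Finite G)
    (hG : IsReflectionGroup G) :
    ∃ (k : ℕ) (δ : Fin k → ℕ) (Gi : ∀ i, Subgroup (O (Euc (δ i))))
      (e : PiLp 2 (fun i => Euc (δ i)) ≃ₗᵢ[ℝ] Euc d),
      IsConstituentDecomposition G Gi e ∧ ∀ i j, Gi i = ⊥ → Gi j = ⊥ → i = j := by
  set F : Submodule ℝ (Euc d) := (Submodule.span ℝ (roots G))ᗮ with hF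
  -- The summands form a set of nonzero subspaces, so linked roots contribute one summand and the
  -- fixed space `F` at most one. Only `F` carries a trivial constituent, which gives uniqueness.
  let I : Set (Submodule ℝ (Euc d)) := {W | W ∈ insert F (linkedSpan G '' roots G) ∧ W ≠ ⊥}
  have hI : I.Finite := (((roots_finite hfin).image _).insert F).subset fun W hW => hW.1
  have hle : ∀ u, linkedSpan G u ≤ Submodule.span ℝ (roots G) := fun u =>
    Submodule.span_mono fun v hv => hv.1
  have hFo : ∀ u, F ⟂ linkedSpan G u := fun u =>
    (Submodule.isOrtho_orthogonal_left _).mono_right (hle u)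
  have hIorth : ∀ W ∈ I, ∀ W' ∈ I, W ≠ W' → W ⟂ W' := by
    rintro W ⟨rfl | ⟨u, hu, rfl⟩, -⟩ W' ⟨rfl | ⟨u', hu', rfl⟩, -⟩ hne
    · exact absurd rfl hne
    · exact hFo u'
    · exact (hFo u).symm
    · exact isOrtho_linkedSpan fun h => hne (linkedSpan_congr h)
  have : Fintype I := hI.fintype
  let eq := (Fintype.equivFin I).symm
  let W : Fin (Fintype.card I) → Submodule ℝ (Euc d) := fun i => eq i
  have hWI : ∀ i, W i ∈ I := fun i => (eq i).2
  have hWinj : ∀ i j, W i = W j → i = j := fun i j h => eq.injective (Subtype.ext h)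
  have hWsurj : ∀ U ∈ I, ∃ i, W i = U := fun U hU => ⟨eq.symm ⟨U, hU⟩, by simp [W]⟩
  have hne_bot : ∀ u ∈ roots G, linkedSpan G u ≠ ⊥ := fun u hu h0 => by
    have := mem_linkedSpan_self hu
    rw [h0, Submodule.mem_bot] at this
    exact ne_zero_of_norm_eq_one hu.1 this
  have hLI : ∀ u ∈ roots G, linkedSpan G u ∈ I := fun u hu =>
    ⟨Or.inr ⟨u, hu, rfl⟩, hne_bot u hu⟩
  obtain ⟨e, hsub, hsurj⟩ := exists_isometry_of_orthogonal W
    (fun i j hij => hIorth _ (hWI i) _ (hWI j) fun h => hij (hWinj i j h)) (fun x hx => by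
      have hxF : x ∈ F := by
        rw [hF, Submodule.mem_orthogonal]
        intro w hw
        induction hw using Submodule.span_induction with
        | mem u hu =>
          obtain ⟨i, hi⟩ := hWsurj _ (hLI u hu)
          exact hx i u (hi ▸ mem_linkedSpan_self hu)
        | zero => exact inner_zero_left _
        | add a b _ _ ha hb => rw [inner_add_left, ha, hb, add_zero]
        | smul c a _ ha => rw [inner_smul_left, ha, mul_zero]
      by_contra hx0
      obtain ⟨i, hi⟩ := hWsurj F ⟨Or.inl rfl, fun h0 => hx0 (by
        rw [h0] at hxF; exact (Submodule.mem_bot ℝ).1 hxF)⟩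
      exact hx0 (inner_self_eq_zero.1 (hx i x (hi ▸ hxF))))
  have hroots : ∀ u ∈ roots G, ∃ i v, e (PiLp.single 2 i v) = u := by
    intro u hu
    obtain ⟨i, hi⟩ := hWsurj _ (hLI u hu)
    obtain ⟨v, hv⟩ := hsurj i u (hi ▸ mem_linkedSpan_self hu)
    exact ⟨i, v, hv⟩
  have hp := isDirectProduct_component hG hroots
  have hδ : ∀ i, 1 ≤ finrank ℝ (W i) := fun i =>
    Submodule.one_le_finrank_iff.2 (hWI i).2
  have hcase : ∀ i, (W i = F ∧ component G e i = ⊥) ∨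
      (IsEssential (component G e i) ∧ IsIrreducible (component G e i)) := by
    intro i
    have hs := hsub i
    have hs' := hsurj i
    rcases (hWI i).1 with h | ⟨u, hu, h⟩
    · left
      refine ⟨h, ?_⟩
      by_contra hne
      obtain ⟨v, hv⟩ := (isReflectionGroup_component i).exists_mem_roots hne
      have hr := single_mem_roots hp hv
      have h1 := h.le (hs v)
      exact ne_zero_of_norm_eq_one hr.1 (inner_self_eq_zero.1 (h1 _ (Submodule.subset_span hr)))
    · right
      have ht : ∀ v, e (PiLp.single 2 i v) ∈ linkedSpan G u := fun v => h.ge (hs v)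
      have ht' : ∀ w ∈ linkedSpan G u, ∃ v, e (PiLp.single 2 i v) = w := fun w hw =>
        hs' w (h.le hw)
      exact ⟨isEssential_component ht ht', isIrreducible_component hp ht ht'⟩
  refine ⟨_, _, component G e, e, ⟨hδ, hp, fun i => ⟨isReflectionGroup_component i,
    (hcase i).imp (fun h => h.2) id⟩⟩, fun i j hi hj => ?_⟩
  have hWF : ∀ i, component G e i = ⊥ → W i = F := by
    intro i hi
    rcases hcase i with h | h
    · exact h.1
    · rw [hi] at h
      exact absurd h.1 (not_isEssential_bot (hδ i))
  exact hWinj i j ((hWF i hi).trans (hWF j hj).symm)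

end Decomposition

end MaxFiltering

/-! ### Assembly of the theorem -/

theorem mainTheorem1 (d : ℕ) (hd : 1 ≤ d)
    (G : Subgroup (MaxFiltering.O (MaxFiltering.Euc d))) (hfin : Finite G)
    (hG : MaxFiltering.IsReflectionGroup G) :
    -- (a)
    (G = ⊥ → MaxFiltering.kappa G = 1 ∧
      ∀ b : OrthonormalBasis (Fin d) ℝ (MaxFiltering.Euc d),
        MaxFiltering.IsMinimalOptimal G b) ∧
    -- (b)
    (MaxFiltering.IsEssential G → MaxFiltering.IsIrreducible G →
      ∀ A : Matrix (Fin d) (Fin d) ℝ, MaxFiltering.IsFundamentalSystem G (MaxFiltering.row A) →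
        IsUnit A.det ∧
        MaxFiltering.kappa G =
          ENNReal.ofReal (MaxFiltering.sigmaMax A / MaxFiltering.sigmaMin A) ∧
        MaxFiltering.IsMinimalOptimal G (MaxFiltering.col A⁻¹)) ∧
    -- (c), existence of a decomposition with at most one trivial constituent
    (∃ (k : ℕ) (δ : Fin k → ℕ) (Gi : ∀ i, Subgroup (MaxFiltering.O (MaxFiltering.Euc (δ i))))
        (e : PiLp 2 (fun i => MaxFiltering.Euc (δ i)) ≃ₗᵢ[ℝ] MaxFiltering.Euc d),
      MaxFiltering.IsConstituentDecomposition G Gi e ∧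
        ∀ i j, Gi i = ⊥ → Gi j = ⊥ → i = j) ∧
    -- (c), properties of every decomposition
    (∀ (k : ℕ) (δ : Fin k → ℕ) (Gi : ∀ i, Subgroup (MaxFiltering.O (MaxFiltering.Euc (δ i))))
        (e : PiLp 2 (fun i => MaxFiltering.Euc (δ i)) ≃ₗᵢ[ℝ] MaxFiltering.Euc d),
      MaxFiltering.IsConstituentDecomposition G Gi e →
        ((∃ i, Gi i = ⊥) ↔ ¬ MaxFiltering.IsEssential G) ∧
        MaxFiltering.kappa G = (⨆ i, MaxFiltering.kappa (Gi i)) ∧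
        ∀ t : ∀ i, Fin (δ i) → MaxFiltering.Euc (δ i),
          (∀ i, MaxFiltering.IsConstituentTemplates (Gi i) (t i)) →
          MaxFiltering.IsMinimalOptimal G (MaxFiltering.directSum e t)) := by
  refine ⟨?_, fun _ _ A hA => ?_, ?_, fun k δ Gi e h => h.properties hd hfin hG⟩
  · rintro rfl
    have : Nonempty (Fin d) := ⟨⟨0, hd⟩⟩
    refine ⟨MaxFiltering.kappa_bot, fun b => ?_⟩
    refine MaxFiltering.isMinimalOptimal_of_kappa_eq hfin hG
      (MaxFiltering.bot_orthonormalBasis b) ?_ (by simp)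
    rw [MaxFiltering.kappa_bot]
    simp
  · obtain ⟨hdet, -, -, -, hb, hk⟩ :=
      MaxFiltering.hasBalancedBounds_of_isFundamentalSystem hd hfin hG hA
    refine ⟨hdet, hk, MaxFiltering.isMinimalOptimal_of_kappa_eq hfin hG hb ?_ (by simp)⟩
    rw [inv_div_inv, hk]
  · exact MaxFiltering.exists_isConstituentDecomposition hfin hG
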